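/- Let $\mathfrak g=\mathfrak g_{\bar 0}\oplus\mathfrak g_{\bar 1}$ be a basic classical Lie superalgebra over $\mathbb C$ (finite-dimensional, simple, with $\mathfrak g_{\bar 1}$ a completely reducible $\mathfrak g_{\bar 0}$-module and with a non-degenerate consistent supersymmetric invariant bilinear form), let $A$ be a commutative associative unital $\mathbb C$-algebra, and let a group $\Gamma$ act on $\mathfrak g$ by (even) Lie superalgebra automorphisms and on $A$ by $\mathbb C$-algebra automorphisms. Let $(\mathfrak g\otimes A)^\Gamma$ be the Lie superalgebra of fixed points of the diagonal action $\gamma(x\otimes a)=\gamma x\otimes\gamma a$ on $\mathfrak g\otimes A$, where $[x\otimes a,y\otimes b]=[x,y]\otimes ab$. Assume that the fixed point superalgebra $\mathfrak g^\Gamma$ is again basic classical, regard it as a subsuperalgebra of $(\mathfrak g\otimes A)^\Gamma$ via $x\mapsto x\otimes 1$, and let $\mathfrak h_\Gamma$ be a Cartan subalgebra of $\mathfrak g^\Gamma_{\bar 0}$. For $\alpha\in\mathfrak h_\Gamma^*$ put $\mathfrak g^\alpha=\{x\in\mathfrak g: [h,x]=\alpha(h)x\ \forall h\in\mathfrak h_\Gamma\}$.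 Fix a triangular decomposition of $\mathfrak g$ that is compatible with $\mathfrak h_\Gamma$: a set $\Phi^+$ of non-zero weights of $\mathfrak h_\Gamma$ on $\mathfrak g$ such that $Q^+=\sum_{\alpha\in\Phi^+}\mathbb N\alpha$ satisfies $Q^+\cap(-Q^+)=\{0\}$ and $$\mathfrak g=\mathfrak n^-\oplus\mathfrak g^0\oplus\mathfrak n^+,\qquad \mathfrak n^{\pm}=\bigoplus_{\alpha\in\Phi^+}\mathfrak g^{\pm\alpha}.$$ Put $\mathfrak n^+_\Gamma=\mathfrak g^\Gamma\cap\mathfrak n^+$. The positive roots of $\mathfrak g^\Gamma$ are the $\alpha\in\Phi^+$ with $(\mathfrak g^\Gamma)_\alpha=\mathfrak g^\Gamma\cap\mathfrak g^\alpha\neq0$; the set $\Delta$ of simple roots consists of those positive roots of $\mathfrak g^\Gamma$ that are not a sum of two positive roots of $\mathfrak g^\Gamma$; and $\Delta_{\bar 0}$ is the set of those $\alpha\in\Delta$ with $(\mathfrak g^\Gamma_{\bar 0})_\alpha\ne0$. For $\alpha\in\Delta_{\bar 0}$ choose $x_\alpha\in(\mathfrak g^\Gamma_{\bar 0})_\alpha$,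 $x_\alpha^-\in(\mathfrak g^\Gamma_{\bar 0})_{-\alpha}$ with $h_\alpha=[x_\alpha,x_\alpha^-]\in\mathfrak h_\Gamma$ and $\alpha(h_\alpha)=2$. Let $\Lambda^+$ be the set of all $\lambda\in\mathfrak h_\Gamma^*$ for which the irreducible $\mathfrak g^\Gamma$-module of highest weight $\lambda$ is finite-dimensional. For $\lambda\in\Lambda^+$ let $\bar V(\lambda)$ be the $\mathfrak g^\Gamma$-module generated by an even vector $v_\lambda$ with defining relations $$\mathfrak n^+_\Gamma v_\lambda=0,\quad hv_\lambda=\lambda(h)v_\lambda\ (h\in\mathfrak h_\Gamma),\quad (x_\alpha^-)^{\lambda(h_\alpha)+1}v_\lambda=0\ (\alpha\in\Delta_{\bar 0}).$$ Let $P=P^\Gamma(\bar V(\lambda))=\mathbf U((\mathfrak g\otimes A)^\Gamma)\otimes_{\mathbf U(\mathfrak g^\Gamma)}\bar V(\lambda)$, where $\mathbf U$ denotes the universal enveloping superalgebra. The global Weyl module is $$W^\Gamma(\lambda)=P^\lambda=P\Big/\sum_{\mu\in\mathfrak h_\Gamma^*,\ \mu\notin\lambda-Q^+}\mathbf U((\mathfrak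 g\otimes A)^\Gamma)P_\mu,\qquad P_\mu=\{p\in P: hp=\mu(h)p\ \forall h\in\mathfrak h_\Gamma\},$$ and $w_\lambda^\Gamma$ denotes the image of $1\otimes v_\lambda$ in it. Then, for every $\lambda\in\Lambda^+$, $W^\Gamma(\lambda)$ is a $(\mathfrak g\otimes A)^\Gamma$-supermodule (with the induced $\mathbb Z_2$-grading) generated by the even vector $w_\lambda^\Gamma$ with defining relations $$(\mathfrak n^+\otimes A)^\Gamma w_\lambda^\Gamma=0,\qquad hw_\lambda^\Gamma=\lambda(h)w_\lambda^\Gamma\ \ (h\in\mathfrak h_\Gamma),\qquad (x_\alpha^-)^{\lambda(h_\alpha)+1}w_\lambda^\Gamma=0\ \ (\alpha\in\Delta_{\bar 0}).$$ That is, $w_\lambda^\Gamma$ generates $W^\Gamma(\lambda)$, and the annihilator of $w_\lambda^\Gamma$ in $\mathbf U((\mathfrak g\otimes A)^\Gamma)$ is the left ideal generated by $(\mathfrak n^+\otimes A)^\Gamma$, by all $h-\lambda(h)$ with $h\in\mathfrak h_\Gamma$, and by all $(x_\alpha^-)^{\lambda(h_\alpha)+1}$ with $\alpha\in\Delta_{\bar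 0}$. -/

import Mathlib

open scoped TensorProduct

noncomputable section

namespace SuperWeyl

universe u v w

/-! ## Lie superalgebras over the complex numbers -/

/-- The Koszul sign `(-1)^{ij}`. -/
def sgn (i j : ZMod 2) : ℂ := (-1) ^ (i.val * j.val)

/-- A complex Lie superalgebra: `L = L_0 ⊕ L_1` with a graded, super skew-symmetric bilinear bracket
that satisfies the super Jacobi identity. -/
class LieSuperalgebra (L : Type u) [AddCommGroup L] [Module ℂ L] where
  part : ZMod 2 → Submodule ℂ L
  isCompl : IsCompl (part 0) (part 1)
  bracket : L →ₗ[ℂ] L →ₗ[ℂ] L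
  bracket_mem : ∀ {i j : ZMod 2} {x y : L}, x ∈ part i → y ∈ part j → bracket x y ∈ part (i + j)
  skew : ∀ {i j : ZMod 2} {x y : L}, x ∈ part i → y ∈ part j →
    bracket x y = -(sgn i j • bracket y x)
  jacobi : ∀ {i j k : ZMod 2} {x y z : L}, x ∈ part i → y ∈ part j → z ∈ part k →
    bracket x (bracket y z) = bracket (bracket x y) z + sgn i j • bracket y (bracket x z)

open LieSuperalgebra

/-! ### The even part as a Lie algebra -/

section EvenPart

variable (L : Type u) [AddCommGroup L] [Module ℂ L] [LieSuperalgebra L]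

/-- The even part of a Lie superalgebra. -/
abbrev EvenPart : Type u := ↥(part (L := L) 0)

instance instLieRingEvenPart : LieRing (EvenPart L) where
  bracket x y := ⟨bracket (x : L) (y : L), by simpa using bracket_mem x.2 y.2⟩
  add_lie x y z := by ext; simp
  lie_add x y z := by ext; simp
  lie_self x := by
    ext
    have h := skew x.2 x.2
    simp only [sgn, ZMod.val_zero, mul_zero, pow_zero, one_smul] at h
    have h2 : (2 : ℂ) • bracket (x : L) (x : L) = 0 := by
      rw [two_smul]
      nth_rewrite 1 [h]
      simp
    simpa using h2
  leibniz_lie x y z := by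
    ext
    have h := jacobi x.2 y.2 z.2
    simpa [sgn] using h

instance instLieAlgebraEvenPart : LieAlgebra ℂ (EvenPart L) where
  lie_smul c x y := by
    ext
    change bracket (x : L) (c • (y : L)) = c • bracket (x : L) (y : L)
    simp

end EvenPart

/-! ### Basic classical Lie superalgebras -/

/-- A basic classical Lie superalgebra: finite dimensional, simple, with odd part completely
reducible over the even part, and with a non-degenerate form that is consistent, supersymmetric
and invariant. -/
structure IsBasicClassical (L : Type u) [AddCommGroup L] [Module ℂ L] [LieSuperalgebra L] :
    Prop where
  finiteDimensional : FiniteDimensional ℂ L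
  bracket_ne_zero : ∃ x y : L, bracket x y ≠ 0
  simple : ∀ I : Submodule ℂ L, I ≤ (I ⊓ part 0) ⊔ (I ⊓ part 1) →
    (∀ x ∈ I, ∀ y : L, bracket x y ∈ I) → I = ⊥ ∨ I = ⊤
  classical : ∀ N : Submodule ℂ L, N ≤ part 1 →
    (∀ x ∈ part (L := L) 0, ∀ y ∈ N, bracket x y ∈ N) →
    ∃ N' : Submodule ℂ L, (∀ x ∈ part (L := L) 0, ∀ y ∈ N', bracket x y ∈ N') ∧
      N ⊓ N' = ⊥ ∧ N ⊔ N' = part 1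
  basic : ∃ B : L →ₗ[ℂ] L →ₗ[ℂ] ℂ,
    (∀ x ∈ part (L := L) 0, ∀ y ∈ part (L := L) 1, B x y = 0) ∧
    (∀ (i j : ZMod 2), ∀ x ∈ part (L := L) i, ∀ y ∈ part (L := L) j, B x y = sgn i j * B y x) ∧
    (∀ x y z : L, B (bracket x y) z = B x (bracket y z)) ∧
    (∀ x : L, (∀ y : L, B x y = 0) → x = 0)

/-! ### Group actions and fixed points -/

/-- An action of a group on a Lie superalgebra by (even) automorphisms. -/
structure SuperAction (Γ : Type w) [Group Γ] (L : Type u) [AddCommGroup L] [Module ℂ L]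
    [LieSuperalgebra L] where
  rep : Representation ℂ Γ L
  map_part : ∀ (γ : Γ) {i : ZMod 2} {x : L}, x ∈ part i → rep γ x ∈ part i
  map_bracket : ∀ (γ : Γ) (x y : L), rep γ (bracket x y) = bracket (rep γ x) (rep γ y)

section Fixed

variable {Γ : Type w} [Group Γ] {L : Type u} [AddCommGroup L] [Module ℂ L] [LieSuperalgebra L]

/-- The subspace `L^Γ` of fixed points. -/
def SuperAction.fixed (ρ : SuperAction Γ L) : Submodule ℂ L where
  carrier := {x | ∀ γ : Γ, ρ.rep γ x = x}
  add_mem' hx hy γ := by rw [map_add, hx γ, hy γ]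
  zero_mem' γ := map_zero _
  smul_mem' c x hx γ := by rw [map_smul, hx γ]

theorem exists_add_of_isCompl {V : Type u} [AddCommGroup V] [Module ℂ V] {p q : Submodule ℂ V}
    (h : IsCompl p q) (x : V) : ∃ y ∈ p, ∃ z ∈ q, y + z = x :=
  Submodule.mem_sup.1 (h.sup_eq_top ▸ Submodule.mem_top)

/-- The fixed point subsuperalgebra `L^Γ`, with the grading and the bracket of `L`. -/
instance instFixed (ρ : SuperAction Γ L) : LieSuperalgebra ↥ρ.fixed where
  part i := (part i).comap ρ.fixed.subtype
  isCompl := by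
    refine ⟨?_, ?_⟩
    · rw [Submodule.disjoint_def]
      intro x h0 h1
      exact Subtype.ext (Submodule.disjoint_def.1 (isCompl (L := L)).disjoint (x : L) h0 h1)
    · rw [codisjoint_iff, eq_top_iff]
      rintro ⟨x, hx⟩ -
      obtain ⟨y, hy, z, hz, hyz⟩ := exists_add_of_isCompl (isCompl (L := L)) x
      have key : ∀ γ, ρ.rep γ y = y := by
        intro γ
        have h1 : ρ.rep γ y + ρ.rep γ z = y + z := by rw [← map_add, hyz, hx γ]
        have h2 : ρ.rep γ y - y = z - ρ.rep γ z := by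
          rw [sub_eq_sub_iff_add_eq_add, h1, add_comm]
        have h3 : ρ.rep γ y - y ∈ part (L := L) 0 := sub_mem (ρ.map_part γ hy) hy
        have h4 : ρ.rep γ y - y ∈ part (L := L) 1 := h2 ▸ sub_mem hz (ρ.map_part γ hz)
        exact sub_eq_zero.1 (Submodule.disjoint_def.1 (isCompl (L := L)).disjoint _ h3 h4)
      have hyF : y ∈ ρ.fixed := key
      have hzF : z ∈ ρ.fixed := by
        have : z = x - y := by rw [← hyz]; abel
        rw [this]
        exact sub_mem hx hyF
      refine Submodule.mem_sup.2 ⟨⟨y, hyF⟩, hy, ⟨z, hzF⟩, hz, Subtype.ext hyz⟩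
  bracket := LinearMap.mk₂ ℂ
    (fun x y => ⟨bracket (x : L) (y : L), fun γ => by rw [ρ.map_bracket, x.2 γ, y.2 γ]⟩)
    (fun x x' y => by ext; simp) (fun c x y => by ext; simp)
    (fun x y y' => by ext; simp) (fun c x y => by ext; simp)
  bracket_mem hx hy := bracket_mem (L := L) hx hy
  skew hx hy := Subtype.ext (skew (L := L) hx hy)
  jacobi hx hy hz := Subtype.ext (jacobi (L := L) hx hy hz)

end Fixed

/-! ### Map superalgebras and equivariant map superalgebras -/

section Map

variable {𝔤 : Type u} [AddCommGroup 𝔤] [Module ℂ 𝔤]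

/-- For a subspace `N` of `𝔤`, the subspace `N ⊗ A` of `𝔤 ⊗ A`. -/
def tensorSub (A : Type v) [CommRing A] [Algebra ℂ A] (N : Submodule ℂ 𝔤) :
    Submodule ℂ (𝔤 ⊗[ℂ] A) :=
  Submodule.span ℂ {t | ∃ x ∈ N, ∃ a : A, t = x ⊗ₜ[ℂ] a}

variable {A : Type v} [CommRing A] [Algebra ℂ A]

theorem tensorSub_induction {N : Submodule ℂ 𝔤} {p : 𝔤 ⊗[ℂ] A → Prop}
    (tmul : ∀ x ∈ N, ∀ a : A, p (x ⊗ₜ[ℂ] a)) (zero : p 0) (add : ∀ s t, p s → p t → p (s + t))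
    {t : 𝔤 ⊗[ℂ] A} (ht : t ∈ tensorSub A N) : p t := by
  have key : ∀ s ∈ tensorSub A N, s ∈ tensorSub A N := fun _ h => h
  refine Submodule.closure_induction (p := fun s _ => p s) zero
    (fun s t _ _ hs ht => add s t hs ht) ?_ (key t ht)
  rintro c s ⟨x, hx, a, rfl⟩
  rw [TensorProduct.smul_tmul']
  exact tmul _ (N.smul_mem c hx) a

variable [LieSuperalgebra 𝔤]

/-- The bracket on `𝔤 ⊗ A` with `[x ⊗ a, y ⊗ b] = [x, y] ⊗ ab`. -/
def mapBracket : 𝔤 ⊗[ℂ] A →ₗ[ℂ] 𝔤 ⊗[ℂ] A →ₗ[ℂ] 𝔤 ⊗[ℂ] A :=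
  TensorProduct.map₂ bracket (LinearMap.mul ℂ A)

theorem mapBracket_tmul (x y : 𝔤) (a b : A) :
    mapBracket (x ⊗ₜ[ℂ] a) (y ⊗ₜ[ℂ] b) = bracket x y ⊗ₜ[ℂ] (a * b) := by
  simp [mapBracket]

/-- The map superalgebra `𝔤 ⊗ A`. -/
instance instMap : LieSuperalgebra (𝔤 ⊗[ℂ] A) where
  part i := tensorSub A (part i)
  isCompl := by
    refine ⟨?_, ?_⟩
    · rw [Submodule.disjoint_def]
      intro t h0 h1
      let P := ((part (L := 𝔤) 0).projection (part 1) isCompl).rTensor A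
      have e0 : P t = t := tensorSub_induction (p := fun t => P t = t)
        (fun x hx a => by
          have := Submodule.projection_apply_left (isCompl (L := 𝔤)) ⟨x, hx⟩
          simp only [P, LinearMap.rTensor_tmul]
          rw [this])
        (map_zero _) (fun s t hs ht => by rw [map_add, hs, ht]) h0
      have e1 : P t = 0 := tensorSub_induction (p := fun t => P t = 0)
        (fun x hx a => by
          have := Submodule.projection_apply_right (isCompl (L := 𝔤)) ⟨x, hx⟩
          simp only [P, LinearMap.rTensor_tmul]
          rw [this, TensorProduct.zero_tmul])
        (map_zero _) (fun s t hs ht => by rw [map_add, hs, ht, add_zero]) h1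
      rw [← e0, e1]
    · rw [codisjoint_iff, eq_top_iff]
      rintro t -
      induction t with
      | zero => exact zero_mem _
      | add s t hs ht => exact add_mem hs ht
      | tmul x a =>
        obtain ⟨y, hy, z, hz, rfl⟩ := exists_add_of_isCompl (isCompl (L := 𝔤)) x
        rw [TensorProduct.add_tmul]
        exact Submodule.add_mem_sup (Submodule.subset_span ⟨y, hy, a, rfl⟩)
          (Submodule.subset_span ⟨z, hz, a, rfl⟩)
  bracket := mapBracket
  bracket_mem {i j s t} hs ht := by
    refine tensorSub_induction (p := fun s => mapBracket s t ∈ tensorSub A (part (i + j)))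
      (fun x hx a => ?_) (by simp)
      (fun s s' h h' => by rw [map_add, LinearMap.add_apply]; exact add_mem h h') hs
    refine tensorSub_induction
      (p := fun t => mapBracket (x ⊗ₜ[ℂ] a) t ∈ tensorSub A (part (i + j)))
      (fun y hy b => ?_) (by simp) (fun s s' h h' => by rw [map_add]; exact add_mem h h') ht
    rw [mapBracket_tmul]
    exact Submodule.subset_span ⟨_, bracket_mem hx hy, _, rfl⟩
  skew {i j s t} hs ht := by
    refine tensorSub_induction (p := fun s => mapBracket s t = -(sgn i j • mapBracket t s))
      (fun x hx a => ?_) (by simp)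
      (fun s s' h h' => by
        rw [map_add, LinearMap.add_apply, h, h', map_add, smul_add, neg_add]) hs
    refine tensorSub_induction
      (p := fun t => mapBracket (x ⊗ₜ[ℂ] a) t = -(sgn i j • mapBracket t (x ⊗ₜ[ℂ] a)))
      (fun y hy b => ?_) (by simp)
      (fun s s' h h' => by
        rw [map_add, h, h', map_add, LinearMap.add_apply, smul_add, neg_add]) ht
    rw [mapBracket_tmul, mapBracket_tmul, skew hx hy, mul_comm b a, TensorProduct.neg_tmul,
      TensorProduct.smul_tmul']
  jacobi {i j k r s t} hr hs ht := by
    refine tensorSub_induction (p := fun r => mapBracket r (mapBracket s t) =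
        mapBracket (mapBracket r s) t + sgn i j • mapBracket s (mapBracket r t))
      (fun x hx a => ?_) (by simp)
      (fun q q' h h' => by
        simp only [map_add, LinearMap.add_apply, smul_add, h, h']; abel) hr
    refine tensorSub_induction (p := fun s => mapBracket (x ⊗ₜ[ℂ] a) (mapBracket s t) =
        mapBracket (mapBracket (x ⊗ₜ[ℂ] a) s) t
          + sgn i j • mapBracket s (mapBracket (x ⊗ₜ[ℂ] a) t))
      (fun y hy b => ?_) (by simp)
      (fun q q' h h' => by
        simp only [map_add, LinearMap.add_apply, smul_add, h, h']; abel) hs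
    refine tensorSub_induction
      (p := fun t => mapBracket (x ⊗ₜ[ℂ] a) (mapBracket (y ⊗ₜ[ℂ] b) t) =
        mapBracket (mapBracket (x ⊗ₜ[ℂ] a) (y ⊗ₜ[ℂ] b)) t
          + sgn i j • mapBracket (y ⊗ₜ[ℂ] b) (mapBracket (x ⊗ₜ[ℂ] a) t))
      (fun z hz c => ?_) (by simp)
      (fun q q' h h' => by
        simp only [map_add, smul_add, h, h']; abel) ht
    simp only [mapBracket_tmul]
    rw [jacobi hx hy hz, TensorProduct.add_tmul, TensorProduct.smul_tmul', mul_assoc,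
      mul_left_comm b a c]

variable {Γ : Type w} [Group Γ]

/-- The diagonal action `γ (x ⊗ a) = γ x ⊗ γ a` on `𝔤 ⊗ A`. -/
def SuperAction.tensor (ρ : SuperAction Γ 𝔤) (τ : Γ →* (A ≃ₐ[ℂ] A)) :
    SuperAction Γ (𝔤 ⊗[ℂ] A) where
  rep :=
    { toFun := fun γ => TensorProduct.map (ρ.rep γ) (τ γ).toLinearMap
      map_one' := by ext x a; simp
      map_mul' := fun γ γ' => by ext x a; simp }
  map_part γ {i t} ht := tensorSub_induction
    (p := fun t => TensorProduct.map (ρ.rep γ) (τ γ).toLinearMap t ∈ tensorSub A (part i))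
    (fun x hx a => Submodule.subset_span ⟨_, ρ.map_part γ hx, τ γ a, by simp⟩)
    (by simp) (fun s t hs ht => by rw [map_add]; exact add_mem hs ht) ht
  map_bracket γ s t := by
    change TensorProduct.map (ρ.rep γ) (τ γ).toLinearMap (mapBracket s t) =
      mapBracket (TensorProduct.map (ρ.rep γ) (τ γ).toLinearMap s)
        (TensorProduct.map (ρ.rep γ) (τ γ).toLinearMap t)
    induction s with
    | zero => simp
    | add s s' h h' => simp only [map_add, LinearMap.add_apply, h, h']
    | tmul x a =>
      induction t with
      | zero => simp
      | add s s' h h' => simp only [map_add, h, h']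
      | tmul y b => simp [mapBracket_tmul, ρ.map_bracket]

/-- The equivariant map superalgebra `(𝔤 ⊗ A)^Γ`. -/
abbrev EquivMap (ρ : SuperAction Γ 𝔤) (τ : Γ →* (A ≃ₐ[ℂ] A)) : Type (max u v) :=
  ↥(ρ.tensor τ).fixed

end Map

/-! ### Homomorphisms and enveloping superalgebras -/

/-- An even homomorphism of Lie superalgebras. -/
structure SuperHom (L : Type u) (M : Type v) [AddCommGroup L] [Module ℂ L] [LieSuperalgebra L]
    [AddCommGroup M] [Module ℂ M] [LieSuperalgebra M] where
  toLin : L →ₗ[ℂ] M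
  map_part : ∀ {i : ZMod 2} {x : L}, x ∈ part i → toLin x ∈ part i
  map_bracket : ∀ x y : L, toLin (bracket x y) = bracket (toLin x) (toLin y)

section Enveloping

variable (L : Type u) [AddCommGroup L] [Module ℂ L] [LieSuperalgebra L]

/-- The relations `x y - (-1)^{|x||y|} y x = [x, y]`, for homogeneous `x` and `y`. -/
inductive EnvRel : TensorAlgebra ℂ L → TensorAlgebra ℂ L → Prop
  | comm {i j : ZMod 2} {x y : L} (hx : x ∈ part i) (hy : y ∈ part j) :
      EnvRel (TensorAlgebra.ι ℂ x * TensorAlgebra.ι ℂ y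
          - sgn i j • (TensorAlgebra.ι ℂ y * TensorAlgebra.ι ℂ x))
        (TensorAlgebra.ι ℂ (bracket x y))

/-- The universal enveloping superalgebra `U(L)`. -/
def Env : Type u := RingQuot (EnvRel L)

instance instRingEnv : Ring (Env L) := inferInstanceAs (Ring (RingQuot (EnvRel L)))

instance instAlgebraEnv : Algebra ℂ (Env L) := inferInstanceAs (Algebra ℂ (RingQuot (EnvRel L)))

variable {L}

/-- The canonical map `L → U(L)`. -/
def Env.ι : L →ₗ[ℂ] Env L :=
  (RingQuot.mkAlgHom ℂ (EnvRel L)).toLinearMap ∘ₗ TensorAlgebra.ι ℂ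

theorem Env.ι_comm {i j : ZMod 2} {x y : L} (hx : x ∈ part i) (hy : y ∈ part j) :
    Env.ι x * Env.ι y - sgn i j • (Env.ι y * Env.ι x) = Env.ι (bracket x y) := by
  have h := RingQuot.mkAlgHom_rel ℂ (EnvRel.comm hx hy)
  rw [map_sub, map_smul, map_mul, map_mul] at h
  exact h

/-- The algebra homomorphism `U(L) → U(M)` induced by a homomorphism `L → M`. -/
def Env.map {M : Type v} [AddCommGroup M] [Module ℂ M] [LieSuperalgebra M] (f : SuperHom L M) :
    Env L →ₐ[ℂ] Env M :=
  RingQuot.liftAlgHom ℂ ⟨TensorAlgebra.lift ℂ (Env.ι ∘ₗ f.toLin), by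
    rintro _ _ ⟨hx, hy⟩
    simp only [map_sub, map_smul, map_mul, TensorAlgebra.lift_ι_apply, LinearMap.comp_apply]
    rw [f.map_bracket]
    exact Env.ι_comm (f.map_part hx) (f.map_part hy)⟩

theorem Env.map_ι {M : Type v} [AddCommGroup M] [Module ℂ M] [LieSuperalgebra M]
    (f : SuperHom L M) (x : L) : Env.map f (Env.ι x) = Env.ι (f.toLin x) := by
  simp only [Env.map, Env.ι]
  erw [RingQuot.liftAlgHom_mkAlgHom_apply]
  simp

/-- Products of homogeneous elements of `L`, with the sum of their parities. -/
inductive Env.IsMonomial : ZMod 2 → Env L → Prop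
  | one : Env.IsMonomial 0 1
  | ι_mul {i j : ZMod 2} {x : L} {m : Env L} (hx : x ∈ part i) (hm : Env.IsMonomial j m) :
      Env.IsMonomial (i + j) (Env.ι x * m)

/-- The parity components `U(L)_0` and `U(L)_1`. -/
def Env.parity (i : ZMod 2) : Submodule ℂ (Env L) := Submodule.span ℂ {m | Env.IsMonomial i m}

/-- The subspaces `W_0` and `W_1` make the `U(L)`-module `W` an `L`-supermodule. -/
def IsSupermodule {W : Type v} [AddCommGroup W] [Module ℂ W] [Module (Env L) W]
    (part : ZMod 2 → Submodule ℂ W) : Prop :=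
  IsCompl (part 0) (part 1) ∧
    ∀ i j : ZMod 2, ∀ a ∈ Env.parity (L := L) i, ∀ m ∈ part j, a • m ∈ part (i + j)

end Enveloping

/-! ### Induced modules -/

section Induced

variable {R : Type u} {S : Type v} [Ring R] [Algebra ℂ R] [Ring S] [Algebra ℂ S]

/-- The `S`-submodule of `S ⊗_ℂ V` generated by all `s r ⊗ m - s ⊗ r m`. -/
def balancing (φ : R →ₐ[ℂ] S) (V : Type w) [AddCommGroup V] [Module ℂ V] [Module R V] :
    Submodule S (S ⊗[ℂ] V) :=
  Submodule.span S {t | ∃ (s : S) (r : R) (m : V),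
    t = (s * φ r) ⊗ₜ[ℂ] m - s ⊗ₜ[ℂ] (r • m)}

/-- The induced module `S ⊗_R V`, for an algebra homomorphism `φ : R → S`. -/
abbrev Induced (φ : R →ₐ[ℂ] S) (V : Type w) [AddCommGroup V] [Module ℂ V] [Module R V] :
    Type (max v w) :=
  (S ⊗[ℂ] V) ⧸ balancing φ V

/-- The class of `s ⊗ m` in `S ⊗_R V`. -/
def Induced.tmul (φ : R →ₐ[ℂ] S) {V : Type w} [AddCommGroup V] [Module ℂ V] [Module R V]
    (s : S) (m : V) : Induced φ V :=
  (balancing φ V).mkQ (s ⊗ₜ[ℂ] m)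

end Induced

/-! ## Triangular decompositions -/

section Triangular

variable {Γ : Type w} [Group Γ] {𝔤 : Type u} [AddCommGroup 𝔤] [Module ℂ 𝔤] [LieSuperalgebra 𝔤]
  {ρ : SuperAction Γ 𝔤}

/-- The inclusion of a subalgebra `𝔥_Γ` of the even part of `𝔤^Γ` into `𝔤^Γ`. -/
def inclFixed (H : LieSubalgebra ℂ (EvenPart ↥ρ.fixed)) : ↥H →ₗ[ℂ] ↥ρ.fixed :=
  (part (L := ↥ρ.fixed) 0).subtype ∘ₗ H.toSubmodule.subtype

/-- `𝔤^α = {x ∈ 𝔤 | [h, x] = α(h) x for all h ∈ 𝔥_Γ}`. -/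
def weightSpace (H : LieSubalgebra ℂ (EvenPart ↥ρ.fixed)) (α : Module.Dual ℂ ↥H) :
    Submodule ℂ 𝔤 where
  carrier := {x | ∀ h : ↥H, bracket (inclFixed H h : 𝔤) x = α h • x}
  add_mem' hx hy h := by rw [map_add, hx h, hy h, smul_add]
  zero_mem' h := by simp
  smul_mem' c x hx h := by rw [map_smul, hx h, smul_comm]

/-- A choice of positive weights of `𝔥_Γ` on `𝔤`, which gives a triangular decomposition
`𝔤 = 𝔫⁻ ⊕ 𝔤^0 ⊕ 𝔫⁺` into sums of weight spaces, and `𝔫⁺_Γ = 𝔤^Γ ∩ 𝔫⁺`. The cone spanned by the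
positive weights is pointed. -/
structure TriangularDecomposition (H : LieSubalgebra ℂ (EvenPart ↥ρ.fixed)) where
  pos : Set (Module.Dual ℂ ↥H)
  weightSpace_ne_bot : ∀ α ∈ pos, weightSpace H α ≠ ⊥
  zero_notMem : (0 : Module.Dual ℂ ↥H) ∉ pos
  pointed : ∀ α ∈ AddSubmonoid.closure pos, -α ∈ AddSubmonoid.closure pos → α = 0
  decomposition :
    (⨆ α ∈ pos, weightSpace H (-α)) ⊔ weightSpace H 0 ⊔ (⨆ α ∈ pos, weightSpace H α) = ⊤

namespace TriangularDecomposition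

variable {H : LieSubalgebra ℂ (EvenPart ↥ρ.fixed)} (T : TriangularDecomposition H)

/-- The positive root lattice `Q⁺ = ∑ ℕ α`, as weights of `𝔥_Γ`. -/
def Qpos : AddSubmonoid (Module.Dual ℂ ↥H) := AddSubmonoid.closure T.pos

/-- `𝔫⁺`, the sum of the positive weight spaces of `𝔤`. -/
def nPos : Submodule ℂ 𝔤 := ⨆ α ∈ T.pos, weightSpace H α

/-- `𝔫⁺_Γ = 𝔤^Γ ∩ 𝔫⁺`. -/
def nPosFixed : Submodule ℂ ↥ρ.fixed := T.nPos.comap ρ.fixed.subtype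

/-- The root space `(𝔤^Γ)_α`. -/
def rootSpace (H : LieSubalgebra ℂ (EvenPart ↥ρ.fixed)) (α : Module.Dual ℂ ↥H) :
    Submodule ℂ ↥ρ.fixed :=
  (weightSpace H α).comap ρ.fixed.subtype

/-- The set `R⁺` of positive roots of `𝔤^Γ`. -/
def posRoots : Set (Module.Dual ℂ ↥H) := {α | α ∈ T.pos ∧ rootSpace H α ≠ ⊥}

/-- The set `Δ` of simple roots: positive roots that are not the sum of two positive roots. -/
def simpleRoots : Set (Module.Dual ℂ ↥H) :=
  {α | α ∈ T.posRoots ∧ ¬ ∃ β ∈ T.posRoots, ∃ γ ∈ T.posRoots, α = β + γ}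

/-- The set `Δ_0` of even simple roots. -/
def evenSimpleRoots : Set (Module.Dual ℂ ↥H) :=
  {α | α ∈ T.simpleRoots ∧ rootSpace H α ⊓ part 0 ≠ ⊥}

/-- Root vectors `x_α`, `x_α^-` and coroots `h_α`, for the even simple roots `α`. -/
structure RootVectors where
  x : T.evenSimpleRoots → ↥ρ.fixed
  xneg : T.evenSimpleRoots → ↥ρ.fixed
  coroot : T.evenSimpleRoots → ↥H
  x_mem : ∀ α : T.evenSimpleRoots, x α ∈ rootSpace H α.1 ⊓ part 0
  xneg_mem : ∀ α : T.evenSimpleRoots, xneg α ∈ rootSpace H (-α.1) ⊓ part 0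
  bracket_eq : ∀ α : T.evenSimpleRoots, bracket (x α) (xneg α) = inclFixed H (coroot α)
  root_coroot : ∀ α : T.evenSimpleRoots, α.1 (coroot α) = 2

/-- The left ideal of `U(𝔤^Γ)` generated by `𝔫⁺_Γ` and all `h - lam(h)`, `h ∈ 𝔥_Γ`. The quotient
by it is the Verma module of highest weight `lam`. -/
def vermaIdeal (lam : Module.Dual ℂ ↥H) : Submodule (Env ↥ρ.fixed) (Env ↥ρ.fixed) :=
  Submodule.span _
    ({a | ∃ x ∈ T.nPosFixed, a = Env.ι x} ∪
      {a | ∃ h : ↥H, a = Env.ι (inclFixed H h) - algebraMap ℂ _ (lam h)})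

/-- The set `Λ⁺` of all `lam` such that the irreducible highest weight module `L(lam)` of `𝔤^Γ`,
that is, the simple quotient of the Verma module, is finite dimensional. -/
def dominant : Set (Module.Dual ℂ ↥H) :=
  {lam | ∃ J : Submodule (Env ↥ρ.fixed) (Env ↥ρ.fixed), IsCoatom J ∧ T.vermaIdeal lam ≤ J ∧
    FiniteDimensional ℂ (Env ↥ρ.fixed ⧸ J)}

end TriangularDecomposition

end Triangular

/-! ## Global Weyl modules -/

section Weyl

open TriangularDecomposition

variable {Γ : Type w} [Group Γ] {𝔤 : Type u} [AddCommGroup 𝔤] [Module ℂ 𝔤] [LieSuperalgebra 𝔤]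
  {ρ : SuperAction Γ 𝔤} {H : LieSubalgebra ℂ (EvenPart ↥ρ.fixed)}
  {T : TriangularDecomposition H}

/-- The left ideal of `U(𝔤^Γ)` generated by `𝔫⁺_Γ`, by `h - lam(h)` for `h ∈ 𝔥_Γ`, and by
`(x_α^-)^{lam(h_α)+1}` for `α ∈ Δ_0`. -/
def vBarIdeal (X : T.RootVectors) (lam : Module.Dual ℂ ↥H) :
    Submodule (Env ↥ρ.fixed) (Env ↥ρ.fixed) :=
  Submodule.span _
    ({a | ∃ x ∈ T.nPosFixed, a = Env.ι x} ∪
      {a | ∃ h : ↥H, a = Env.ι (inclFixed H h) - algebraMap ℂ _ (lam h)} ∪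
      {a | ∃ (α : T.evenSimpleRoots) (k : ℕ), lam (X.coroot α) = k ∧
        a = Env.ι (X.xneg α) ^ (k + 1)})

/-- The `𝔤^Γ`-module `V̄(lam)`. -/
abbrev VBar (X : T.RootVectors) (lam : Module.Dual ℂ ↥H) : Type u :=
  Env ↥ρ.fixed ⧸ vBarIdeal X lam

/-- The generator `v_lam` of `V̄(lam)`. -/
def vBar (X : T.RootVectors) (lam : Module.Dual ℂ ↥H) : VBar X lam := (vBarIdeal X lam).mkQ 1

/-- The parity components of `V̄(lam)`, with `v_lam` even. -/
def VBar.parity (X : T.RootVectors) (lam : Module.Dual ℂ ↥H) (i : ZMod 2) :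
    Submodule ℂ (VBar X lam) :=
  (Env.parity i).map ((vBarIdeal X lam).mkQ.restrictScalars ℂ)

variable {A : Type v} [CommRing A] [Algebra ℂ A]

/-- The inclusion `𝔤^Γ → (𝔤 ⊗ A)^Γ`, `x ↦ x ⊗ 1`. -/
def constHom (ρ : SuperAction Γ 𝔤) (τ : Γ →* (A ≃ₐ[ℂ] A)) :
    SuperHom ↥ρ.fixed (EquivMap ρ τ) where
  toLin := LinearMap.codRestrict (ρ.tensor τ).fixed
    ((TensorProduct.mk ℂ 𝔤 A).flip 1 ∘ₗ ρ.fixed.subtype)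
    (fun x γ => by
      change TensorProduct.map (ρ.rep γ) (τ γ).toLinearMap ((x : 𝔤) ⊗ₜ[ℂ] (1 : A)) =
        (x : 𝔤) ⊗ₜ[ℂ] (1 : A)
      simp [x.2 γ])
  map_part hx := Submodule.subset_span ⟨_, hx, 1, rfl⟩
  map_bracket x y := by
    apply Subtype.ext
    change bracket (x : 𝔤) (y : 𝔤) ⊗ₜ[ℂ] (1 : A) =
      mapBracket ((x : 𝔤) ⊗ₜ[ℂ] (1 : A)) ((y : 𝔤) ⊗ₜ[ℂ] (1 : A))
    rw [mapBracket_tmul, mul_one]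

variable (τ : Γ →* (A ≃ₐ[ℂ] A)) (X : T.RootVectors) (lam : Module.Dual ℂ ↥H)

/-- `P^Γ(V̄(lam)) = U((𝔤 ⊗ A)^Γ) ⊗_{U(𝔤^Γ)} V̄(lam)`. -/
abbrev PVBar : Type (max u v) := Induced (Env.map (constHom ρ τ)) (VBar X lam)

/-- The parity components of `P^Γ(V̄(lam))`. -/
def PVBar.parity (i : ZMod 2) : Submodule ℂ (PVBar τ X lam) :=
  Submodule.span ℂ {p | ∃ (j k : ZMod 2), j + k = i ∧
    ∃ a ∈ Env.parity (L := EquivMap ρ τ) j, ∃ m ∈ VBar.parity X lam k,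
      p = Induced.tmul (Env.map (constHom ρ τ)) a m}

/-- The weight space, of weight `μ` for `𝔥_Γ`, of a `(𝔤 ⊗ A)^Γ`-module. -/
def moduleWeightSpace (H : LieSubalgebra ℂ (EvenPart ↥ρ.fixed)) (V : Type*) [AddCommGroup V]
    [Module ℂ V] [Module (Env (EquivMap ρ τ)) V] (μ : Module.Dual ℂ ↥H) : Set V :=
  {m | ∀ h : ↥H, (Env.ι ((constHom ρ τ).toLin (inclFixed H h)) : Env (EquivMap ρ τ)) • m
    = μ h • m}

/-- `∑_{μ ∉ ν - Q⁺} U((𝔤 ⊗ A)^Γ) V_μ`. -/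
def truncation (T : TriangularDecomposition H) (V : Type*) [AddCommGroup V]
    [Module ℂ V] [Module (Env (EquivMap ρ τ)) V] (ν : Module.Dual ℂ ↥H) :
    Submodule (Env (EquivMap ρ τ)) V :=
  ⨆ (μ : Module.Dual ℂ ↥H) (_ : ν - μ ∉ T.Qpos),
    Submodule.span (Env (EquivMap ρ τ)) (moduleWeightSpace τ H V μ)

/-- The global Weyl module `W^Γ(lam) = P^Γ(V̄(lam))^lam`. -/
abbrev GlobalWeyl : Type (max u v) := PVBar τ X lam ⧸ truncation τ T (PVBar τ X lam) lam

/-- The image `w_lam^Γ` of `v_lam = 1 ⊗ v_lam` in `W^Γ(lam)`. -/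
def globalWeylVector : GlobalWeyl τ X lam :=
  (truncation τ T (PVBar τ X lam) lam).mkQ
    (Induced.tmul (Env.map (constHom ρ τ)) 1 (vBar X lam))

/-- The parity components of `W^Γ(lam)`. -/
def GlobalWeyl.parity (i : ZMod 2) : Submodule ℂ (GlobalWeyl τ X lam) :=
  (PVBar.parity τ X lam i).map ((truncation τ T (PVBar τ X lam) lam).mkQ.restrictScalars ℂ)

/-- The left ideal of `U((𝔤 ⊗ A)^Γ)` generated by `(𝔫⁺ ⊗ A)^Γ`, by `h - lam(h)` for `h ∈ 𝔥_Γ`, and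
by `(x_α^-)^{lam(h_α)+1}` for `α ∈ Δ_0`. -/
def weylRelations : Submodule (Env (EquivMap ρ τ)) (Env (EquivMap ρ τ)) :=
  Submodule.span _
    ({a | ∃ t : EquivMap ρ τ, (t : 𝔤 ⊗[ℂ] A) ∈ tensorSub A T.nPos ∧ a = Env.ι t} ∪
      {a | ∃ h : ↥H, a = Env.ι ((constHom ρ τ).toLin (inclFixed H h)) - algebraMap ℂ _ (lam h)} ∪
      {a | ∃ (α : T.evenSimpleRoots) (k : ℕ), lam (X.coroot α) = k ∧
        a = Env.ι ((constHom ρ τ).toLin (X.xneg α)) ^ (k + 1)})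

end Weyl

end SuperWeyl

end

open scoped TensorProduct
open SuperWeyl

noncomputable section

namespace SuperWeyl

universe u v w

open LieSuperalgebra TriangularDecomposition

/-! ## Simultaneous eigenspaces -/

section Eigenspaces

variable {V : Type*} [AddCommGroup V] [Module ℂ V] {ι κ : Type*}

/-! Write `U` for the enveloping superalgebra of `(𝔤 ⊗ A)^Γ`, `I` for `weylRelations` and `w` for
the generator. The induced module `P` is cyclic on `1 ⊗ v`, so `W^Γ(lam)` is cyclic on `w`, and the
point is that the annihilator of `w` equals `I`.

`I` kills `w`: the weight relations and the powers of `x_α^-` already hold for `v`. An element of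
`(𝔫⁺ ⊗ A)^Γ` is a sum of invariant weight vectors, because `Γ` fixes `𝔥_Γ` pointwise and hence
preserves weight spaces. A component of weight `α ∈ Φ⁺` sends `1 ⊗ v` to weight `lam + α`, which is
outside `lam - Q⁺` because `Q⁺` is pointed, so the truncation kills it (`ι_smul_globalWeylVector`).

Nothing else kills `w`: the relations of `v` map into `I`, so there is a `U`-linear map `P → U/I`
with `1 ⊗ v ↦ 1` (`Induced.toQuotient`). All weights of `U/I` lie in `lam - Q⁺`
(`moduleWeightSpace_eq_zero`), so this map vanishes on the truncated submodule. Hence `a • w = 0`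
makes the class of `a` in `U/I` zero.

The grading: `I` is stable under the parity automorphism of `U`, so `U/I`, and with it `W^Γ(lam)`,
inherits the grading of `U`. -/

theorem iSupIndep_of_eigenvalues (E : ι → Submodule ℂ V) (f : κ → V →ₗ[ℂ] V) (χ : ι → κ → ℂ)
    (hχ : Function.Injective χ) (hE : ∀ i, ∀ v ∈ E i, ∀ k, f k v = χ i k • v) : iSupIndep E := by
  classical
  rw [iSupIndep_iff_finsetSum_eq_zero_imp_eq_zero]
  intro s
  induction s using Finset.induction_on with
  | empty => simp
  | insert j s hj ih =>
    intro v hv hsum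
    rw [Finset.sum_insert hj] at hsum
    have hs : ∀ i ∈ s, v i = 0 := by
      intro i hi
      obtain ⟨k, hk⟩ : ∃ k, χ i k ≠ χ j k := by
        by_contra! h
        exact hj ((hχ (funext h)) ▸ hi)
      -- Applying `f k - χ j k` to the relation removes the term `v j` and scales each other `v i`
      -- by a factor; the factor of the chosen `i` is non-zero.
      have h1 := ih (fun i => (χ i k - χ j k) • v i)
        (fun i hi => (E i).smul_mem _ (hv i (Finset.mem_insert_of_mem hi))) (by
          have h2 : f k (v j + ∑ i ∈ s, v i) = 0 := by rw [hsum, map_zero]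
          rw [map_add, map_sum, hE j _ (hv j (Finset.mem_insert_self _ _))] at h2
          have h3 : ∑ i ∈ s, f k (v i) = ∑ i ∈ s, χ i k • v i :=
            Finset.sum_congr rfl fun i hi => hE i _ (hv i (Finset.mem_insert_of_mem hi)) k
          simp only [sub_smul, Finset.sum_sub_distrib]
          rw [← h3, ← Finset.smul_sum, eq_neg_of_add_eq_zero_right h2,
            eq_neg_of_add_eq_zero_right hsum]
          simp) i hi
      exact (smul_eq_zero.1 h1).resolve_left (sub_ne_zero.2 hk)
    intro i hi
    rcases Finset.mem_insert.1 hi with rfl | hi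
    · rwa [Finset.sum_eq_zero hs, add_zero] at hsum
    · exact hs i hi

/-- The components of a fixed vector in an invariant family of independent subspaces are fixed. -/
theorem exists_finsupp_fixed {G : Type*} {E : ι → Submodule ℂ V} (hE : iSupIndep E)
    (g : G → V →ₗ[ℂ] V) (hg : ∀ γ i, ∀ v ∈ E i, g γ v ∈ E i) {v : V} (hv : v ∈ ⨆ i, E i)
    (hfix : ∀ γ, g γ v = v) :
    ∃ f : ι →₀ V, (∀ i, f i ∈ E i) ∧ (∀ i γ, g γ (f i) = f i) ∧ ∑ i ∈ f.support, f i = v := by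
  obtain ⟨f, hf, rfl⟩ := (Submodule.mem_iSup_iff_exists_finsupp _ _).1 hv
  refine ⟨f, hf, fun i γ => ?_, rfl⟩
  by_cases hi : i ∈ f.support
  · rw [iSupIndep_iff_finsetSum_eq_zero_imp_eq_zero] at hE
    -- The differences `g γ (f i) - f i` stay in the summands and add up to `g γ v - v = 0`.
    refine sub_eq_zero.1 (hE f.support (fun i => g γ (f i) - f i)
      (fun i _ => sub_mem (hg γ i _ (hf i)) (hf i)) ?_ i hi)
    have := hfix γ
    rw [Finsupp.sum, map_sum] at this
    rw [Finset.sum_sub_distrib, this, sub_self]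
  · rw [Finsupp.notMem_support_iff.1 hi, map_zero]

end Eigenspaces

/-! ## Parity -/

theorem sgn_zero_left (i : ZMod 2) : sgn 0 i = 1 := by simp [sgn]

/-- The sign `(-1)^i`. -/
def paritySign (i : ZMod 2) : ℂ := sgn 1 i

theorem paritySign_zero : paritySign 0 = 1 := by simp [paritySign, sgn]

theorem paritySign_one : paritySign 1 = -1 := by simp [paritySign, sgn, ZMod.val_one]

theorem zmod_two_eq (i : ZMod 2) : i = 0 ∨ i = 1 := by
  fin_cases i
  · exact Or.inl rfl
  · exact Or.inr rfl

theorem paritySign_add (i j : ZMod 2) : paritySign (i + j) = paritySign i * paritySign j := by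
  have h2 : (1 : ZMod 2) + 1 = 0 := rfl
  rcases zmod_two_eq i with rfl | rfl <;> rcases zmod_two_eq j with rfl | rfl <;>
    simp [paritySign_zero, paritySign_one, h2]

theorem paritySign_injective : Function.Injective paritySign := by
  intro i j h
  have h1 : (1 : ℂ) ≠ -1 := by norm_num
  rcases zmod_two_eq i with rfl | rfl <;> rcases zmod_two_eq j with rfl | rfl <;>
    simp only [paritySign_zero, paritySign_one] at h
  exacts [rfl, (h1 h).elim, (h1 h.symm).elim, rfl]

section Parity

variable {L : Type u} [AddCommGroup L] [Module ℂ L] [LieSuperalgebra L]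

theorem exists_parity_add (x : L) : ∃ y ∈ part (L := L) 0, ∃ z ∈ part (L := L) 1, y + z = x :=
  exists_add_of_isCompl isCompl x

variable (L) in
/-- The linear map `x ↦ (-1)^{|x|} x`. -/
def parityLin : L →ₗ[ℂ] L :=
  (2 : ℂ) • (part (L := L) 0).projection (part 1) isCompl - LinearMap.id

theorem parityLin_apply {i : ZMod 2} {x : L} (hx : x ∈ part i) :
    parityLin L x = paritySign i • x := by
  rcases zmod_two_eq i with rfl | rfl
  · have := Submodule.projection_apply_left (isCompl (L := L)) ⟨x, hx⟩
    simp only at this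
    rw [parityLin, LinearMap.sub_apply, LinearMap.smul_apply, this, paritySign_zero,
      two_smul, LinearMap.id_apply, one_smul, add_sub_cancel_right]
  · have := Submodule.projection_apply_right (isCompl (L := L)) ⟨x, hx⟩
    simp only at this
    simp [parityLin, this, paritySign_one]

variable (L) in
/-- The automorphism `x ↦ (-1)^{|x|} x`. -/
def parityHom : SuperHom L L where
  toLin := parityLin L
  map_part hx := by rw [parityLin_apply hx]; exact Submodule.smul_mem _ _ hx
  map_bracket x y := by
    have key : ∀ {i j : ZMod 2} {x y : L}, x ∈ part i → y ∈ part j →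
        parityLin L (bracket x y) = bracket (parityLin L x) (parityLin L y) := by
      intro i j x y hx hy
      rw [parityLin_apply hx, parityLin_apply hy, parityLin_apply (bracket_mem hx hy),
        paritySign_add]
      simp [mul_smul]
      rw [smul_comm]
    obtain ⟨x0, hx0, x1, hx1, rfl⟩ := exists_parity_add x
    obtain ⟨y0, hy0, y1, hy1, rfl⟩ := exists_parity_add y
    simp only [map_add, LinearMap.add_apply, key hx0 hy0, key hx0 hy1, key hx1 hy0, key hx1 hy1]

/-- The automorphism `a ↦ (-1)^{|a|} a` of the enveloping superalgebra. -/
def Env.grade : Env L →ₐ[ℂ] Env L := Env.map (parityHom L)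

theorem Env.grade_ι {i : ZMod 2} {x : L} (hx : x ∈ part i) :
    Env.grade (Env.ι x) = paritySign i • Env.ι x := by
  rw [Env.grade, Env.map_ι, ← map_smul, ← parityLin_apply hx]
  rfl

theorem Env.grade_apply {i : ZMod 2} {a : Env L} (ha : a ∈ Env.parity i) :
    Env.grade a = paritySign i • a := by
  refine Submodule.span_induction (p := fun a _ => Env.grade a = paritySign i • a) ?_ (by simp)
    (fun a b _ _ ha hb => by rw [map_add, ha, hb, smul_add])
    (fun c a _ ha => by rw [map_smul, ha, smul_comm]) ha
  intro m hm
  clear ha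
  induction hm with
  | one => simp [paritySign_zero]
  | ι_mul hx _ ih =>
    rw [map_mul, Env.grade_ι hx, ih, paritySign_add, smul_mul_smul_comm]

/-- A subspace that is stable under `L` is stable under `U(L)`. -/
theorem Env.smul_mem {V : Type*} [AddCommGroup V] [Module ℂ V] [Module (Env L) V]
    [IsScalarTower ℂ (Env L) V] (N : Submodule ℂ V) (hN : ∀ x : L, ∀ m ∈ N, Env.ι x • m ∈ N)
    (a : Env L) {m : V} (hm : m ∈ N) : a • m ∈ N := by
  let π : TensorAlgebra ℂ L →ₐ[ℂ] Env L := RingQuot.mkAlgHom ℂ (EnvRel L)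
  have hι : ∀ x, π (TensorAlgebra.ι ℂ x) = Env.ι x := fun _ => rfl
  obtain ⟨t, rfl⟩ : ∃ t, π t = a := RingQuot.mkAlgHom_surjective ℂ (EnvRel L) a
  clear_value π
  induction t using TensorAlgebra.induction generalizing m with
  | algebraMap c =>
    rw [AlgHom.commutes, algebraMap_smul]
    exact N.smul_mem c hm
  | ι x =>
    rw [hι]
    exact hN x m hm
  | mul a b ha hb =>
    rw [map_mul, mul_smul]
    exact ha (hb hm)
  | add a b ha hb =>
    rw [map_add, add_smul]
    exact add_mem (ha hm) (hb hm)

theorem Env.one_mem_parity : (1 : Env L) ∈ Env.parity 0 :=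
  Submodule.subset_span Env.IsMonomial.one

theorem Env.ι_mul_mem_parity {i j : ZMod 2} {x : L} {a : Env L} (hx : x ∈ part i)
    (ha : a ∈ Env.parity j) : Env.ι x * a ∈ Env.parity (i + j) := by
  refine Submodule.span_induction (p := fun a _ => Env.ι x * a ∈ Env.parity (i + j))
    (fun m hm => Submodule.subset_span (Env.IsMonomial.ι_mul hx hm)) (by simp)
    (fun a b _ _ ha hb => by rw [mul_add]; exact add_mem ha hb)
    (fun c a _ ha => by rw [mul_smul_comm]; exact Submodule.smul_mem _ _ ha) ha

theorem Env.mul_mem_parity {i j : ZMod 2} {a b : Env L} (ha : a ∈ Env.parity i)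
    (hb : b ∈ Env.parity j) : a * b ∈ Env.parity (i + j) := by
  refine Submodule.span_induction (p := fun a _ => a * b ∈ Env.parity (i + j)) ?_ (by simp)
    (fun a a' _ _ ha ha' => by rw [add_mul]; exact add_mem ha ha')
    (fun c a _ ha => by rw [smul_mul_assoc]; exact Submodule.smul_mem _ _ ha) ha
  intro m hm
  clear ha
  induction hm with
  | one => rwa [one_mul, zero_add]
  | ι_mul hx _ ih =>
    rw [mul_assoc, add_assoc]
    exact Env.ι_mul_mem_parity hx ih

/-- The sum of the two components contains `1` and is stable under left multiplication by `L`, hence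
by `U(L)`. Directness is not needed here. -/
theorem Env.parity_sup : Env.parity (L := L) 0 ⊔ Env.parity 1 = ⊤ := by
  have key : ∀ {i j : ZMod 2} {x : L} {a : Env L}, x ∈ part i → a ∈ Env.parity j →
      Env.ι x * a ∈ Env.parity (L := L) 0 ⊔ Env.parity 1 := by
    intro i j x a hx ha
    have h := Env.ι_mul_mem_parity hx ha
    generalize i + j = k at h
    rcases zmod_two_eq k with rfl | rfl
    · exact Submodule.mem_sup_left h
    · exact Submodule.mem_sup_right h
  rw [eq_top_iff]
  rintro a -
  rw [← mul_one a]
  refine Env.smul_mem _ (fun x m hm => ?_) a (Submodule.mem_sup_left Env.one_mem_parity)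
  obtain ⟨x0, hx0, x1, hx1, rfl⟩ := exists_parity_add x
  obtain ⟨a0, ha0, a1, ha1, rfl⟩ := Submodule.mem_sup.1 hm
  simp only [smul_eq_mul, map_add, add_mul, mul_add]
  exact add_mem (add_mem (key hx0 ha0) (key hx1 ha0)) (add_mem (key hx0 ha1) (key hx1 ha1))

theorem Env.map_mem_parity {M : Type v} [AddCommGroup M] [Module ℂ M] [LieSuperalgebra M]
    (f : SuperHom L M) {i : ZMod 2} {a : Env L} (ha : a ∈ Env.parity i) :
    Env.map f a ∈ Env.parity i := by
  refine Submodule.span_induction (p := fun a _ => Env.map f a ∈ Env.parity i) ?_ (by simp)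
    (fun a b _ _ ha hb => by rw [map_add]; exact add_mem ha hb)
    (fun c a _ ha => by rw [map_smul]; exact Submodule.smul_mem _ _ ha) ha
  intro m hm
  clear ha
  induction hm with
  | one => rw [map_one]; exact Env.one_mem_parity
  | ι_mul hx _ ih =>
    rw [map_mul, Env.map_ι]
    exact Env.ι_mul_mem_parity (f.map_part hx) ih

/-- A module generated by one vector whose annihilator is stable under `Env.grade` is a
supermodule. -/
theorem isSupermodule_of_cyclic {W : Type v} [AddCommGroup W] [Module ℂ W] [Module (Env L) W]
    [IsScalarTower ℂ (Env L) W] {w : W} (hw : Submodule.span (Env L) {w} = ⊤)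
    (hgrade : ∀ a : Env L, a • w = 0 → Env.grade a • w = 0) (P : ZMod 2 → Submodule ℂ W)
    (hP : ∀ i m, m ∈ P i ↔ ∃ a ∈ Env.parity (L := L) i, a • w = m) :
    IsSupermodule (L := L) P := by
  refine ⟨⟨?_, ?_⟩, ?_⟩
  · rw [Submodule.disjoint_def]
    intro m h0 h1
    obtain ⟨a, ha, rfl⟩ := (hP _ _).1 h0
    obtain ⟨b, hb, hab⟩ := (hP _ _).1 h1
    -- For `a` even, `b` odd and `a • w = b • w`, applying the grading automorphism to `a - b` gives
    -- `(a + b) • w = 0`, that is, twice the vector is zero.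
    have h := hgrade (a - b) (by rw [sub_smul, hab, sub_self])
    rw [map_sub, Env.grade_apply ha, Env.grade_apply hb, paritySign_zero, paritySign_one,
      sub_smul, smul_assoc, smul_assoc, hab, ← sub_smul] at h
    refine (smul_eq_zero.1 h).resolve_left ?_
    norm_num
  · rw [codisjoint_iff, eq_top_iff]
    rintro m -
    obtain ⟨a, rfl⟩ := Submodule.mem_span_singleton.1 (hw ▸ Submodule.mem_top : m ∈ _)
    obtain ⟨a0, h0, a1, h1, rfl⟩ :=
      Submodule.mem_sup.1 (Env.parity_sup (L := L) ▸ Submodule.mem_top : a ∈ _)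
    rw [add_smul]
    exact Submodule.add_mem_sup ((hP _ _).2 ⟨a0, h0, rfl⟩) ((hP _ _).2 ⟨a1, h1, rfl⟩)
  · intro i j a ha m hm
    obtain ⟨b, hb, rfl⟩ := (hP _ _).1 hm
    exact (hP _ _).2 ⟨a * b, Env.mul_mem_parity ha hb, mul_smul _ _ _⟩

end Parity

/-! ## Homogeneous weight vectors of equivariant map superalgebras -/

section TensorSub

variable {𝔤 : Type u} [AddCommGroup 𝔤] [Module ℂ 𝔤] {A : Type v} [CommRing A] [Algebra ℂ A]

theorem tensorSub_mono {N N' : Submodule ℂ 𝔤} (h : N ≤ N') : tensorSub A N ≤ tensorSub A N' :=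
  Submodule.span_mono fun _ ⟨x, hx, a, hxa⟩ => ⟨x, h hx, a, hxa⟩

theorem tensorSub_top : tensorSub A (⊤ : Submodule ℂ 𝔤) = ⊤ := by
  rw [eq_top_iff]
  rintro t -
  induction t with
  | zero => exact zero_mem _
  | add s t hs ht => exact add_mem hs ht
  | tmul x a => exact Submodule.subset_span ⟨x, trivial, a, rfl⟩

theorem tensorSub_iSup_le {ι : Sort*} (N : ι → Submodule ℂ 𝔤) :
    tensorSub A (⨆ i, N i) ≤ ⨆ i, tensorSub A (N i) := by
  refine Submodule.span_le.2 ?_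
  rintro _ ⟨x, hx, a, rfl⟩
  have h : ⨆ i, N i ≤ (⨆ i, tensorSub A (N i)).comap ((TensorProduct.mk ℂ 𝔤 A).flip a) :=
    iSup_le fun i y hy => Submodule.mem_iSup_of_mem i (Submodule.subset_span ⟨y, hy, a, rfl⟩)
  exact h hx

end TensorSub

section EquivMap

variable {Γ : Type w} [Group Γ] {𝔤 : Type u} [AddCommGroup 𝔤] [Module ℂ 𝔤] [LieSuperalgebra 𝔤]
  {ρ : SuperAction Γ 𝔤} (H : LieSubalgebra ℂ (EvenPart ↥ρ.fixed))
  {A : Type v} [CommRing A] [Algebra ℂ A]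

/-- Elements of `𝔥_Γ` are even, so their adjoint action respects parity and the two components of a
weight vector are weight vectors. Parity has to be tracked because the commutation relations of `U`
are available only for homogeneous elements. -/
theorem weightSpace_le_parity (α : Module.Dual ℂ ↥H) :
    weightSpace (ρ := ρ) H α ≤ ⨆ i : ZMod 2, weightSpace H α ⊓ part i := by
  intro x hx
  obtain ⟨y, hy, z, hz, rfl⟩ := exists_parity_add x
  have key : ∀ h : ↥H, bracket (inclFixed H h : 𝔤) y = α h • y ∧
      bracket (inclFixed H h : 𝔤) z = α h • z := by
    intro h
    have h0 : (inclFixed H h : 𝔤) ∈ part (L := 𝔤) 0 := h.1.2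
    have h1 := hx h
    rw [map_add, smul_add] at h1
    have h2 : bracket (inclFixed H h : 𝔤) y - α h • y = α h • z - bracket (inclFixed H h : 𝔤) z :=
      sub_eq_sub_iff_add_eq_add.2 (by rw [h1, add_comm])
    have h3 : bracket (inclFixed H h : 𝔤) y - α h • y ∈ part (L := 𝔤) 0 :=
      sub_mem (by simpa using bracket_mem h0 hy) (Submodule.smul_mem _ _ hy)
    have h4 : bracket (inclFixed H h : 𝔤) y - α h • y ∈ part (L := 𝔤) 1 :=
      h2 ▸ sub_mem (Submodule.smul_mem _ _ hz) (by simpa using bracket_mem h0 hz)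
    have h5 := Submodule.disjoint_def.1 (isCompl (L := 𝔤)).disjoint _ h3 h4
    exact ⟨sub_eq_zero.1 h5, (sub_eq_zero.1 (h2.symm.trans h5)).symm⟩
  exact add_mem (Submodule.mem_iSup_of_mem 0 ⟨fun h => (key h).1, hy⟩)
    (Submodule.mem_iSup_of_mem 1 ⟨fun h => (key h).2, hz⟩)

/-- `𝔥_Γ` lies in `𝔤^Γ`, so `Γ` commutes with its adjoint action. -/
theorem rep_mem_weightSpace (γ : Γ) {α : Module.Dual ℂ ↥H} {x : 𝔤} (hx : x ∈ weightSpace H α) :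
    ρ.rep γ x ∈ weightSpace H α := by
  intro h
  have h1 : ρ.rep γ (inclFixed H h : 𝔤) = (inclFixed H h : 𝔤) := (inclFixed H h).2 γ
  rw [← map_smul, ← hx h, ρ.map_bracket, h1]

theorem iSupIndep_tensorSub_weightSpace :
    iSupIndep fun p : Module.Dual ℂ ↥H × ZMod 2 =>
      tensorSub A (weightSpace (ρ := ρ) H p.1 ⊓ part p.2) := by
  -- The commuting data are the parity operator, indexed by `none`, and the brackets with `h ⊗ 1`,
  -- indexed by `some h`; together their eigenvalues determine both weight and parity.
  refine iSupIndep_of_eigenvalues (κ := Option ↥H) _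
    (fun k => k.elim (parityLin (𝔤 ⊗[ℂ] A))
      (fun h => mapBracket ((inclFixed H h : 𝔤) ⊗ₜ[ℂ] (1 : A))))
    (fun p k => k.elim (paritySign p.2) (fun h => p.1 h)) ?_ ?_
  · rintro ⟨α, i⟩ ⟨β, j⟩ h
    exact Prod.ext (LinearMap.ext fun k => congrFun h (some k))
      (paritySign_injective (congrFun h none))
  · rintro ⟨α, i⟩ t ht (_ | h)
    · exact parityLin_apply (L := 𝔤 ⊗[ℂ] A) (tensorSub_mono inf_le_right ht)
    · refine tensorSub_induction (p := fun t =>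
        mapBracket ((inclFixed H h : 𝔤) ⊗ₜ[ℂ] (1 : A)) t = α h • t) ?_ (by simp)
        (fun s t hs ht => by rw [map_add, hs, ht, smul_add]) ht
      intro x hx a
      rw [mapBracket_tmul, hx.1 h, one_mul, TensorProduct.smul_tmul']

variable (τ : Γ →* (A ≃ₐ[ℂ] A))

/-- The elements of weight `α` and parity `i` in `(𝔤 ⊗ A)^Γ`. -/
def homogWeight (α : Module.Dual ℂ ↥H) (i : ZMod 2) : Submodule ℂ (EquivMap ρ τ) :=
  (tensorSub A (weightSpace H α ⊓ part i)).comap (ρ.tensor τ).fixed.subtype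

variable {H τ}

theorem homogWeight_le_part (α : Module.Dual ℂ ↥H) (i : ZMod 2) :
    homogWeight (ρ := ρ) H τ α i ≤ part i :=
  fun _ ht => tensorSub_mono inf_le_right ht

theorem constHom_mem_part (h : ↥H) : (constHom ρ τ).toLin (inclFixed H h) ∈ part 0 :=
  (constHom ρ τ).map_part h.1.2

theorem bracket_constHom {α : Module.Dual ℂ ↥H} {i : ZMod 2} {t : EquivMap ρ τ}
    (ht : t ∈ homogWeight H τ α i) (h : ↥H) :
    bracket ((constHom ρ τ).toLin (inclFixed H h)) t = α h • t := by
  apply Subtype.ext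
  change mapBracket ((inclFixed H h : 𝔤) ⊗ₜ[ℂ] (1 : A)) (t : 𝔤 ⊗[ℂ] A) = α h • (t : 𝔤 ⊗[ℂ] A)
  refine tensorSub_induction (p := fun t =>
    mapBracket ((inclFixed H h : 𝔤) ⊗ₜ[ℂ] (1 : A)) t = α h • t) ?_ (by simp)
    (fun s t hs ht => by rw [map_add, hs, ht, smul_add]) ht
  intro x hx a
  rw [mapBracket_tmul, hx.1 h, one_mul, TensorProduct.smul_tmul']

/-- Invariants in `(∑ 𝔤^α) ⊗ A` are sums of invariant homogeneous weight vectors. -/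
theorem mem_iSup_homogWeight (S : Set (Module.Dual ℂ ↥H)) {t : EquivMap ρ τ}
    (ht : (t : 𝔤 ⊗[ℂ] A) ∈ tensorSub A (⨆ α ∈ S, weightSpace H α)) :
    t ∈ ⨆ (α ∈ S) (i : ZMod 2), homogWeight H τ α i := by
  let E : S × ZMod 2 → Submodule ℂ (𝔤 ⊗[ℂ] A) := fun p =>
    tensorSub A (weightSpace (ρ := ρ) H p.1.1 ⊓ part p.2)
  have hE : iSupIndep E := (iSupIndep_tensorSub_weightSpace (A := A) H).comp
    (f := fun p : S × ZMod 2 => (p.1.1, p.2))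
    (fun p q h => Prod.ext (Subtype.ext (Prod.mk.inj h).1) (Prod.mk.inj h).2)
  have hle : ⨆ α ∈ S, weightSpace (ρ := ρ) H α ≤
      ⨆ p : S × ZMod 2, weightSpace H p.1.1 ⊓ part p.2 := by
    refine iSup₂_le fun α hα => (weightSpace_le_parity H α).trans (iSup_le fun i => ?_)
    exact le_iSup (fun p : S × ZMod 2 => weightSpace (ρ := ρ) H p.1.1 ⊓ part p.2) (⟨α, hα⟩, i)
  -- The diagonal action preserves each summand `E p`, so the components of the invariant `t` are
  -- themselves invariant.
  obtain ⟨f, hf, hfix, hsum⟩ := exists_finsupp_fixed hE (fun γ => (ρ.tensor τ).rep γ)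
    (fun γ p v hv => tensorSub_induction (N := weightSpace (ρ := ρ) H p.1.1 ⊓ part p.2)
      (p := fun t => TensorProduct.map (ρ.rep γ) (τ γ).toLinearMap t ∈ E p)
      (fun x hx a => Submodule.subset_span
        ⟨_, ⟨rep_mem_weightSpace H γ hx.1, ρ.map_part γ hx.2⟩, τ γ a, by simp⟩)
      (by simp) (fun s t hs ht => by rw [map_add]; exact add_mem hs ht) hv)
    (tensorSub_iSup_le _ (tensorSub_mono hle ht)) t.2
  have h : t = ∑ p ∈ f.support, (⟨f p, hfix p⟩ : EquivMap ρ τ) :=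
    Subtype.ext (by rw [← hsum, AddSubmonoidClass.coe_finsetSum])
  rw [h]
  refine sum_mem fun p _ => ?_
  exact Submodule.mem_iSup_of_mem p.1.1 (Submodule.mem_iSup_of_mem p.1.2
    (Submodule.mem_iSup_of_mem p.2 (hf p)))

theorem homogWeight_le_tensorSub_nPos (T : TriangularDecomposition H) {α : Module.Dual ℂ ↥H}
    (hα : α ∈ T.pos) {i : ZMod 2} {t : EquivMap ρ τ} (ht : t ∈ homogWeight H τ α i) :
    (t : 𝔤 ⊗[ℂ] A) ∈ tensorSub A T.nPos :=
  tensorSub_mono (inf_le_left.trans (le_biSup (weightSpace H) hα)) ht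

/-- Every element of `(𝔤 ⊗ A)^Γ` is a sum of homogeneous vectors with positive weight or with
weight in `-Q⁺`. -/
theorem iSup_homogWeight_eq_top (T : TriangularDecomposition H) :
    ⨆ (α ∈ {α | α ∈ T.pos ∨ -α ∈ T.Qpos}) (i : ZMod 2), homogWeight (ρ := ρ) H τ α i = ⊤ := by
  rw [eq_top_iff]
  rintro t -
  refine mem_iSup_homogWeight _ ?_
  refine tensorSub_mono (N := ⊤) ?_ (tensorSub_top (𝔤 := 𝔤) (A := A) ▸ Submodule.mem_top)
  rw [← T.decomposition]
  refine sup_le (sup_le (iSup₂_le fun α hα => ?_) ?_) (iSup₂_le fun α hα => ?_)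
  · refine le_biSup (weightSpace H) (Or.inr ?_)
    rw [neg_neg]
    exact AddSubmonoid.subset_closure hα
  · refine le_biSup (weightSpace H) (Or.inr ?_)
    rw [neg_zero]
    exact zero_mem _
  · exact le_biSup (weightSpace H) (Or.inl hα)

/-! ## Weights of highest weight modules -/

variable {V : Type*} [AddCommGroup V] [Module ℂ V] [Module (Env (EquivMap ρ τ)) V]
  [IsScalarTower ℂ (Env (EquivMap ρ τ)) V]

/-- Since `h` is even, no sign appears: `h t = t h + [h, t]` with `[h, t] = α(h) t`. -/
theorem ι_smul_mem_moduleWeightSpace {α μ : Module.Dual ℂ ↥H} {i : ZMod 2} {t : EquivMap ρ τ}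
    (ht : t ∈ homogWeight H τ α i) {m : V} (hm : m ∈ moduleWeightSpace τ H V μ) :
    Env.ι t • m ∈ moduleWeightSpace τ H V (μ + α) := by
  intro h
  have h1 := Env.ι_comm (constHom_mem_part (ρ := ρ) (τ := τ) h) (homogWeight_le_part α i ht)
  rw [sgn_zero_left, one_smul, bracket_constHom ht, map_smul, sub_eq_iff_eq_add] at h1
  rw [← mul_smul, h1, add_smul, mul_smul, hm h, smul_assoc, smul_algebra_smul_comm,
    LinearMap.add_apply, add_smul, add_comm]

variable (τ) in
/-- The vectors obtained from `w` by the successive action of homogeneous weight vectors of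
`(𝔤 ⊗ A)^Γ` with weights in `-Q⁺`. -/
inductive LowerMonomial (T : TriangularDecomposition H) (w : V) : V → Prop
  | base : LowerMonomial T w w
  | step {α : Module.Dual ℂ ↥H} {i : ZMod 2} {t : EquivMap ρ τ} {m : V} (hα : -α ∈ T.Qpos)
      (ht : t ∈ homogWeight H τ α i) (hm : LowerMonomial T w m) :
      LowerMonomial T w ((Env.ι t : Env (EquivMap ρ τ)) • m)

variable {T : TriangularDecomposition H}

theorem LowerMonomial.exists_weight {lam : Module.Dual ℂ ↥H} {w m : V}
    (hw : w ∈ moduleWeightSpace τ H V lam) (hm : LowerMonomial τ T w m) :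
    ∃ μ, lam - μ ∈ T.Qpos ∧ m ∈ moduleWeightSpace τ H V μ := by
  induction hm with
  | base => exact ⟨lam, by rw [sub_self]; exact zero_mem _, hw⟩
  | @step α i t m hα ht _ ih =>
    obtain ⟨μ, hμ, hm⟩ := ih
    refine ⟨μ + α, ?_, ι_smul_mem_moduleWeightSpace ht hm⟩
    rw [← sub_sub, sub_eq_add_neg]
    exact add_mem hμ hα

/-- This takes the role of a PBW argument: positive factors are commuted to the right until they
reach `w`, which they kill, so lower monomials alone span the module generated by `w`. -/
theorem LowerMonomial.ι_smul_mem {w m : V}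
    (hw : ∀ t : EquivMap ρ τ, (t : 𝔤 ⊗[ℂ] A) ∈ tensorSub A T.nPos →
      (Env.ι t : Env (EquivMap ρ τ)) • w = 0)
    (hm : LowerMonomial τ T w m) (t : EquivMap ρ τ) :
    (Env.ι t : Env (EquivMap ρ τ)) • m ∈ Submodule.span ℂ {m | LowerMonomial τ T w m} := by
  let N : Submodule ℂ V := Submodule.span ℂ {m | LowerMonomial τ T w m}
  have lower : ∀ {α : Module.Dual ℂ ↥H} {i : ZMod 2} {t : EquivMap ρ τ}, -α ∈ T.Qpos →
      t ∈ homogWeight H τ α i → ∀ n ∈ N, (Env.ι t : Env (EquivMap ρ τ)) • n ∈ N := by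
    intro α i t hα ht n hn
    refine Submodule.span_induction (p := fun n _ => (Env.ι t : Env (EquivMap ρ τ)) • n ∈ N)
      (fun n hn => Submodule.subset_span (LowerMonomial.step hα ht hn)) (by simp)
      (fun a b _ _ ha hb => by rw [smul_add]; exact add_mem ha hb)
      (fun c a _ ha => by rw [smul_algebra_smul_comm]; exact N.smul_mem _ ha) hn
  have act : ∀ (m : V), (∀ α ∈ {α | α ∈ T.pos ∨ -α ∈ T.Qpos}, ∀ i, ∀ t ∈ homogWeight H τ α i,
      (Env.ι t : Env (EquivMap ρ τ)) • m ∈ N) →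
      ∀ t : EquivMap ρ τ, (Env.ι t : Env (EquivMap ρ τ)) • m ∈ N := by
    intro m h t
    let f : EquivMap ρ τ →ₗ[ℂ] V :=
      ((LinearMap.toSpanSingleton (Env (EquivMap ρ τ)) V m).restrictScalars ℂ) ∘ₗ Env.ι
    have hle : ⨆ (α ∈ {α | α ∈ T.pos ∨ -α ∈ T.Qpos}) (i : ZMod 2), homogWeight H τ α i ≤
        N.comap f := iSup₂_le fun α hα => iSup_le fun i t ht => h α hα i t ht
    rw [iSup_homogWeight_eq_top] at hle
    exact hle (Submodule.mem_top : t ∈ ⊤)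
  change (Env.ι t : Env (EquivMap ρ τ)) • m ∈ N
  induction hm generalizing t with
  | base =>
    refine act _ (fun α hα i t ht => ?_) t
    rcases hα with hα | hα
    · rw [hw t (homogWeight_le_tensorSub_nPos T hα ht)]
      exact zero_mem _
    · exact lower hα ht _ (Submodule.subset_span .base)
  | @step β j y m hβ hy hm ih =>
    refine act _ (fun α hα i t ht => ?_) t
    rcases hα with hα | hα
    -- Here `t y m = ± y t m + [t, y] m`. The bracket may have a positive or a lower weight, which
    -- is why the induction hypothesis covers every element of `(𝔤 ⊗ A)^Γ`.
    · have h1 := Env.ι_comm (homogWeight_le_part α i ht) (homogWeight_le_part β j hy)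
      rw [sub_eq_iff_eq_add] at h1
      rw [← mul_smul, h1, add_smul, smul_assoc, mul_smul]
      exact add_mem (ih _) (N.smul_mem _ (lower hβ hy _ (ih _)))
    · exact lower hα ht _ (Submodule.subset_span (LowerMonomial.step hβ hy hm))

/-- A module generated by a highest weight vector of weight `lam` has weights in `lam - Q⁺`. -/
theorem moduleWeightSpace_eq_zero {lam μ : Module.Dual ℂ ↥H} {w : V}
    (hn : ∀ t : EquivMap ρ τ, (t : 𝔤 ⊗[ℂ] A) ∈ tensorSub A T.nPos →
      (Env.ι t : Env (EquivMap ρ τ)) • w = 0)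
    (hw : w ∈ moduleWeightSpace τ H V lam)
    (hgen : Submodule.span (Env (EquivMap ρ τ)) {w} = ⊤) (hμ : lam - μ ∉ T.Qpos) {m : V}
    (hm : m ∈ moduleWeightSpace τ H V μ) : m = 0 := by
  let E : Module.Dual ℂ ↥H → Submodule ℂ V := fun μ =>
    { carrier := moduleWeightSpace τ H V μ
      add_mem' := fun ha hb h => by rw [smul_add, ha h, hb h, smul_add]
      zero_mem' := fun h => by rw [smul_zero, smul_zero]
      smul_mem' := fun c a ha h => by rw [smul_algebra_smul_comm, ha h, smul_comm] }
  have hE : iSupIndep E := iSupIndep_of_eigenvalues (κ := ↥H) E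
    (fun h => Algebra.lsmul ℂ ℂ V (Env.ι ((constHom ρ τ).toLin (inclFixed H h)) :
      Env (EquivMap ρ τ))) (fun μ h => μ h) DFunLike.coe_injective (fun μ v hv h => hv h)
  have hm' : m ∈ ⨆ ν ∈ {ν | lam - ν ∈ T.Qpos}, E ν := by
    obtain ⟨a, rfl⟩ := Submodule.mem_span_singleton.1 (hgen ▸ Submodule.mem_top : m ∈ _)
    have h1 : a • w ∈ Submodule.span ℂ {m | LowerMonomial τ T w m} := by
      refine Env.smul_mem _ (fun t m hm => ?_) a (Submodule.subset_span .base)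
      refine Submodule.span_induction (p := fun m _ => (Env.ι t : Env (EquivMap ρ τ)) • m ∈
        Submodule.span ℂ {m | LowerMonomial τ T w m})
        (fun m hm => LowerMonomial.ι_smul_mem hn hm t) (by simp)
        (fun a b _ _ ha hb => by rw [smul_add]; exact add_mem ha hb)
        (fun c a _ ha => by rw [smul_algebra_smul_comm]; exact Submodule.smul_mem _ _ ha) hm
    refine Submodule.span_le.2 ?_ h1
    intro m hm
    obtain ⟨ν, hν, hmν⟩ := LowerMonomial.exists_weight hw hm
    exact Submodule.mem_iSup_of_mem ν (Submodule.mem_iSup_of_mem hν hmν)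
  -- `m` lies in `E μ` and in the sum of the `E ν` with `ν ∈ lam - Q⁺`; these are independent since
  -- `μ` is not among the `ν`.
  exact Submodule.disjoint_def.1 
    (hE.disjoint_biSup (x := μ) (y := {ν | lam - ν ∈ T.Qpos}) hμ) m hm hm'

end EquivMap

/-! ## Induced cyclic modules -/

section Induced

variable {R : Type u} {S : Type v} [Ring R] [Algebra ℂ R] [Ring S] [Algebra ℂ S] (φ : R →ₐ[ℂ] S)

theorem Induced.smul_tmul {V : Type w} [AddCommGroup V] [Module ℂ V] [Module R V] (s s' : S)
    (m : V) : s • Induced.tmul φ s' m = Induced.tmul φ (s * s') m := rfl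

theorem Induced.tmul_smul {V : Type w} [AddCommGroup V] [Module ℂ V] [Module R V] (s : S) (r : R)
    (m : V) : Induced.tmul φ s (r • m) = Induced.tmul φ (s * φ r) m := by
  refine ((Submodule.Quotient.eq (balancing φ V)).2 (Submodule.subset_span ⟨s, r, m, rfl⟩)).symm

variable (J : Submodule R R)

/-- Moving `r` across the tensor sign shows that inducing a cyclic module gives a cyclic module. -/
theorem Induced.tmul_mkQ (s : S) (r : R) :
    Induced.tmul φ s (J.mkQ r) = (s * φ r) • Induced.tmul φ 1 (J.mkQ 1) := by
  rw [Induced.smul_tmul, mul_one, ← Induced.tmul_smul, ← map_smul, smul_eq_mul, mul_one]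

theorem Induced.exists_smul (p : Induced φ (R ⧸ J)) :
    ∃ s : S, s • Induced.tmul φ 1 (J.mkQ 1) = p := by
  obtain ⟨t, rfl⟩ := (balancing φ (R ⧸ J)).mkQ_surjective p
  induction t with
  | zero => exact ⟨0, by rw [zero_smul, map_zero]⟩
  | add a b ha hb =>
    obtain ⟨s, hs⟩ := ha
    obtain ⟨s', hs'⟩ := hb
    exact ⟨s + s', by rw [add_smul, hs, hs', map_add]⟩
  | tmul s m =>
    obtain ⟨r, rfl⟩ := J.mkQ_surjective m
    exact ⟨s * φ r, (Induced.tmul_mkQ φ J s r).symm⟩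

variable {φ J} (I : Submodule S S) (hJ : ∀ r ∈ J, φ r ∈ I)

/-- The map `R / J → S / I` induced by `φ`. -/
def quotientMap : (R ⧸ J) →ₗ[ℂ] (S ⧸ I) where
  toFun := Submodule.mapQ J I (φ : R →+* S).toSemilinearMap hJ
  map_add' := map_add _
  map_smul' c m := by
    obtain ⟨r, rfl⟩ := J.mkQ_surjective m
    change I.mkQ (φ (c • r)) = c • I.mkQ (φ r)
    rw [map_smul]
    rfl

theorem quotientMap_mkQ (r : R) : quotientMap I hJ (J.mkQ r) = I.mkQ (φ r) := rfl

/-- The homomorphism `S ⊗_R (R / J) → S / I` that sends `1 ⊗ 1` to `1`. -/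
def Induced.toQuotient : Induced φ (R ⧸ J) →ₗ[S] (S ⧸ I) :=
  (balancing φ (R ⧸ J)).liftQ
    (TensorProduct.AlgebraTensorModule.lift
      (LinearMap.toSpanSingleton S ((R ⧸ J) →ₗ[ℂ] (S ⧸ I)) (quotientMap I hJ))) (by
    refine Submodule.span_le.2 ?_
    rintro _ ⟨s, r, m, rfl⟩
    -- With `m` the class of `r'`, both terms of the generator go to the class of `s * φ r * φ r'`.
    obtain ⟨r', rfl⟩ := J.mkQ_surjective m
    rw [SetLike.mem_coe, LinearMap.mem_ker, map_sub, sub_eq_zero]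
    rw [← map_smul J.mkQ]
    change (s * φ r) • quotientMap I hJ (J.mkQ r') = s • quotientMap I hJ (J.mkQ (r • r'))
    rw [quotientMap_mkQ, quotientMap_mkQ, smul_eq_mul, map_mul, mul_smul, ← smul_eq_mul (φ r),
      map_smul])

theorem Induced.toQuotient_smul (s : S) :
    Induced.toQuotient I hJ (s • Induced.tmul φ 1 (J.mkQ 1)) = I.mkQ s := by
  rw [map_smul]
  change s • (1 : S) • I.mkQ (φ 1) = I.mkQ s
  rw [one_smul, map_one, ← map_smul, smul_eq_mul, mul_one]

end Induced

/-! ## The global Weyl module -/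

section Weyl

variable {Γ : Type w} [Group Γ] {𝔤 : Type u} [AddCommGroup 𝔤] [Module ℂ 𝔤] [LieSuperalgebra 𝔤]
  {ρ : SuperAction Γ 𝔤} {H : LieSubalgebra ℂ (EvenPart ↥ρ.fixed)}
  {T : TriangularDecomposition H} {A : Type v} [CommRing A] [Algebra ℂ A]
  (τ : Γ →* (A ≃ₐ[ℂ] A)) (X : T.RootVectors) (lam : Module.Dual ℂ ↥H)

theorem ι_mem_weylRelations {t : EquivMap ρ τ} (ht : (t : 𝔤 ⊗[ℂ] A) ∈ tensorSub A T.nPos) :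
    Env.ι t ∈ weylRelations τ X lam :=
  Submodule.subset_span (Or.inl (Or.inl ⟨t, ht, rfl⟩))

/-- Generators go to generators, as `𝔫⁺_Γ ⊗ 1` lies in `(𝔫⁺ ⊗ A)^Γ`. This is what makes the map `P →
U/I` well defined. -/
theorem map_mem_weylRelations {r : Env ↥ρ.fixed} (hr : r ∈ vBarIdeal X lam) :
    Env.map (constHom ρ τ) r ∈ weylRelations τ X lam := by
  have hle : vBarIdeal X lam ≤ (weylRelations τ X lam).comap
      (Env.map (constHom ρ τ) : Env ↥ρ.fixed →+* Env (EquivMap ρ τ)).toSemilinearMap := by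
    refine Submodule.span_le.2 ?_
    rintro a ((⟨x, hx, rfl⟩ | ⟨h, rfl⟩) | ⟨α, k, hk, rfl⟩)
    · change Env.map (constHom ρ τ) (Env.ι x) ∈ weylRelations τ X lam
      rw [Env.map_ι]
      exact ι_mem_weylRelations τ X lam (Submodule.subset_span ⟨_, hx, 1, rfl⟩)
    · change Env.map (constHom ρ τ) (Env.ι _ - algebraMap ℂ _ (lam h)) ∈ weylRelations τ X lam
      rw [map_sub, Env.map_ι, AlgHom.commutes]
      exact Submodule.subset_span (Or.inl (Or.inr ⟨h, rfl⟩))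
    · change Env.map (constHom ρ τ) (Env.ι (X.xneg α) ^ (k + 1)) ∈ weylRelations τ X lam
      rw [map_pow, Env.map_ι]
      exact Submodule.subset_span (Or.inr ⟨α, k, hk, rfl⟩)
  exact hle hr

theorem grade_mem_weylRelations {a : Env (EquivMap ρ τ)} (ha : a ∈ weylRelations τ X lam) :
    Env.grade a ∈ weylRelations τ X lam := by
  refine Submodule.span_induction (p := fun a _ => Env.grade a ∈ weylRelations τ X lam) ?_
    (by simp) (fun a b _ _ ha hb => by rw [map_add]; exact add_mem ha hb)
    (fun s a _ ha => by rw [smul_eq_mul, map_mul]; exact Submodule.smul_mem _ _ ha) ha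
  rintro a ((⟨t, ht, rfl⟩ | ⟨h, rfl⟩) | ⟨α, k, hk, rfl⟩)
  -- The generator `t` need not be homogeneous, but its homogeneous components are again generators,
  -- and each is only multiplied by a sign.
  · have hle : ⨆ (α ∈ T.pos) (i : ZMod 2), homogWeight H τ α i ≤
        ((weylRelations τ X lam).restrictScalars ℂ).comap
          ((Env.grade (L := EquivMap ρ τ)).toLinearMap ∘ₗ Env.ι) := by
      refine iSup₂_le fun α hα => iSup_le fun i y hy => ?_
      change Env.grade (Env.ι y) ∈ (weylRelations τ X lam).restrictScalars ℂ
      rw [Env.grade_ι (homogWeight_le_part α i hy)]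
      exact Submodule.smul_mem _ _
        (ι_mem_weylRelations τ X lam (homogWeight_le_tensorSub_nPos T hα hy))
    exact hle (mem_iSup_homogWeight T.pos ht)
  · rw [map_sub, Env.grade_ι (constHom_mem_part h), paritySign_zero, one_smul, AlgHom.commutes]
    exact Submodule.subset_span (Or.inl (Or.inr ⟨h, rfl⟩))
  · rw [map_pow, Env.grade_ι ((constHom ρ τ).map_part (X.xneg_mem α).2), paritySign_zero, one_smul]
    exact Submodule.subset_span (Or.inr ⟨α, k, hk, rfl⟩)

theorem smul_globalWeylVector (a : Env (EquivMap ρ τ)) :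
    a • globalWeylVector τ X lam = (truncation τ T (PVBar τ X lam) lam).mkQ
      (a • Induced.tmul (Env.map (constHom ρ τ)) 1 (vBar X lam)) := rfl

theorem span_globalWeylVector :
    Submodule.span (Env (EquivMap ρ τ)) {globalWeylVector τ X lam} = ⊤ := by
  rw [eq_top_iff]
  rintro m -
  obtain ⟨p, rfl⟩ := Submodule.mkQ_surjective _ m
  obtain ⟨a, rfl⟩ := Induced.exists_smul _ _ p
  exact Submodule.mem_span_singleton.2 ⟨a, rfl⟩

/-- The tensor product grading agrees with the one transported from `U`, because `a ⊗ b v = a φ(b)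
(1 ⊗ v)` and `φ` preserves parity. This is the form that `isSupermodule_of_cyclic` needs. -/
theorem mem_globalWeyl_parity (i : ZMod 2) (m : GlobalWeyl τ X lam) :
    m ∈ GlobalWeyl.parity τ X lam i ↔
      ∃ a ∈ Env.parity (L := EquivMap ρ τ) i, a • globalWeylVector τ X lam = m := by
  constructor
  · rintro ⟨p, hp, rfl⟩
    refine Submodule.span_induction (p := fun p _ => ∃ a ∈ Env.parity (L := EquivMap ρ τ) i,
      a • globalWeylVector τ X lam = (truncation τ T (PVBar τ X lam) lam).mkQ p)
      ?_ ⟨0, zero_mem _, by rw [zero_smul, map_zero]⟩ ?_ ?_ hp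
    · rintro _ ⟨j, k, rfl, a, ha, _, ⟨b, hb, rfl⟩, rfl⟩
      refine ⟨a * Env.map (constHom ρ τ) b,
        Env.mul_mem_parity ha (Env.map_mem_parity _ hb), ?_⟩
      rw [smul_globalWeylVector]
      exact congrArg _ (Induced.tmul_mkQ _ _ a b).symm
    · rintro _ _ _ _ ⟨a, ha, hap⟩ ⟨b, hb, hbp⟩
      exact ⟨a + b, add_mem ha hb, by rw [add_smul, hap, hbp, map_add]⟩
    · rintro c p _ ⟨a, ha, hap⟩
      exact ⟨c • a, Submodule.smul_mem _ _ ha, by rw [smul_assoc, hap]; rfl⟩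
  · rintro ⟨a, ha, rfl⟩
    refine ⟨a • Induced.tmul (Env.map (constHom ρ τ)) 1 (vBar X lam), ?_, rfl⟩
    refine Submodule.subset_span ⟨i, 0, add_zero i, a, ha, vBar X lam,
      ⟨1, Env.one_mem_parity, rfl⟩, ?_⟩
    rw [Induced.smul_tmul, mul_one]

theorem constHom_smul_vBar (h : ↥H) :
    (Env.ι ((constHom ρ τ).toLin (inclFixed H h)) : Env (EquivMap ρ τ)) •
        Induced.tmul (Env.map (constHom ρ τ)) 1 (vBar X lam) =
      lam h • Induced.tmul (Env.map (constHom ρ τ)) 1 (vBar X lam) := by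
  have h1 : (Env.ι (inclFixed H h) : Env ↥ρ.fixed) • vBar X lam =
      algebraMap ℂ (Env ↥ρ.fixed) (lam h) • vBar X lam := by
    rw [← sub_eq_zero, ← sub_smul, vBar, ← map_smul, smul_eq_mul, mul_one]
    exact (Submodule.Quotient.mk_eq_zero _).2
      (Submodule.subset_span (Or.inl (Or.inr ⟨h, rfl⟩)))
  rw [Induced.smul_tmul, mul_one, ← Env.map_ι, ← one_mul (Env.map _ _), ← Induced.tmul_smul, h1,
    Induced.tmul_smul, AlgHom.commutes, one_mul, ← mul_one (algebraMap _ _ _),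
    ← Induced.smul_tmul, algebraMap_smul]

theorem map_smul_vBar {r : Env ↥ρ.fixed} (hr : r ∈ vBarIdeal X lam) :
    Env.map (constHom ρ τ) r • Induced.tmul (Env.map (constHom ρ τ)) 1 (vBar X lam) = 0 := by
  have h1 : r • vBar X lam = 0 := by
    rw [vBar, ← map_smul, smul_eq_mul, mul_one]
    exact (Submodule.Quotient.mk_eq_zero _).2 hr
  rw [Induced.smul_tmul, mul_one, ← one_mul (Env.map _ _), ← Induced.tmul_smul, h1, Induced.tmul,
    TensorProduct.tmul_zero, map_zero]

/-- This is the one family of relations that comes from the truncation and not from `V̄(lam)`. -/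
theorem ι_smul_globalWeylVector {t : EquivMap ρ τ}
    (ht : (t : 𝔤 ⊗[ℂ] A) ∈ tensorSub A T.nPos) :
    (Env.ι t : Env (EquivMap ρ τ)) • globalWeylVector τ X lam = 0 := by
  let f : EquivMap ρ τ →ₗ[ℂ] GlobalWeyl τ X lam :=
    ((LinearMap.toSpanSingleton (Env (EquivMap ρ τ)) _
      (globalWeylVector τ X lam)).restrictScalars ℂ) ∘ₗ Env.ι
  have hle : ⨆ (α ∈ T.pos) (i : ZMod 2), homogWeight H τ α i ≤ LinearMap.ker f := by
    refine iSup₂_le fun α hα => iSup_le fun i y hy => ?_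
    change (Env.ι y : Env (EquivMap ρ τ)) • globalWeylVector τ X lam = 0
    rw [smul_globalWeylVector]
    refine (Submodule.Quotient.mk_eq_zero _).2 ?_
    refine Submodule.mem_iSup_of_mem (lam + α) (Submodule.mem_iSup_of_mem ?_
      (Submodule.subset_span (ι_smul_mem_moduleWeightSpace hy (constHom_smul_vBar τ X lam))))
    -- `lam - (lam + α) = -α`; if this were in `Q⁺`, pointedness would force `α = 0`, which is not a
    -- positive weight.
    intro h
    rw [sub_add_cancel_left] at h
    exact T.zero_notMem (T.pointed α (AddSubmonoid.subset_closure hα) h ▸ hα)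
  exact hle (mem_iSup_homogWeight T.pos ht)

theorem map_smul_globalWeylVector {r : Env ↥ρ.fixed} (hr : r ∈ vBarIdeal X lam) :
    Env.map (constHom ρ τ) r • globalWeylVector τ X lam = 0 := by
  rw [smul_globalWeylVector, map_smul_vBar τ X lam hr, map_zero]

theorem smul_globalWeylVector_eq_zero {a : Env (EquivMap ρ τ)}
    (ha : a ∈ weylRelations τ X lam) : a • globalWeylVector τ X lam = 0 := by
  refine Submodule.span_induction (p := fun a _ => a • globalWeylVector τ X lam = 0) ?_
    (zero_smul _ _) (fun a b _ _ ha hb => by rw [add_smul, ha, hb, add_zero])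
    (fun s a _ ha => by rw [smul_eq_mul, mul_smul, ha, smul_zero]) ha
  rintro a ((⟨t, ht, rfl⟩ | ⟨h, rfl⟩) | ⟨α, k, hk, rfl⟩)
  · exact ι_smul_globalWeylVector τ X lam ht
  · have h1 : Env.ι (inclFixed H h) - algebraMap ℂ (Env ↥ρ.fixed) (lam h) ∈ vBarIdeal X lam :=
      Submodule.subset_span (Or.inl (Or.inr ⟨h, rfl⟩))
    have h2 := map_smul_globalWeylVector τ X lam h1
    rwa [map_sub, Env.map_ι, AlgHom.commutes] at h2
  · have h1 : Env.ι (X.xneg α) ^ (k + 1) ∈ vBarIdeal X lam :=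
      Submodule.subset_span (Or.inr ⟨α, k, hk, rfl⟩)
    have h2 := map_smul_globalWeylVector τ X lam h1
    rwa [map_pow, Env.map_ι] at h2

theorem mem_weylRelations_of_smul_eq_zero {a : Env (EquivMap ρ τ)}
    (ha : a • globalWeylVector τ X lam = 0) : a ∈ weylRelations τ X lam := by
  let I := weylRelations τ X lam
  let f : PVBar τ X lam →ₗ[Env (EquivMap ρ τ)] Env (EquivMap ρ τ) ⧸ I :=
    Induced.toQuotient I (fun r hr => map_mem_weylRelations τ X lam hr)
  have mk_smul : ∀ b, b • I.mkQ 1 = I.mkQ b := fun b => by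
    rw [← map_smul, smul_eq_mul, mul_one]
  have hn : ∀ t : EquivMap ρ τ, (t : 𝔤 ⊗[ℂ] A) ∈ tensorSub A T.nPos →
      (Env.ι t : Env (EquivMap ρ τ)) • I.mkQ 1 = 0 := fun t ht => by
    rw [mk_smul]
    exact (Submodule.Quotient.mk_eq_zero _).2 (ι_mem_weylRelations τ X lam ht)
  have hw : I.mkQ 1 ∈ moduleWeightSpace τ H (Env (EquivMap ρ τ) ⧸ I) lam := fun h => by
    rw [← sub_eq_zero, ← algebraMap_smul (Env (EquivMap ρ τ)) (lam h), ← sub_smul, mk_smul]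
    exact (Submodule.Quotient.mk_eq_zero _).2
      (Submodule.subset_span (Or.inl (Or.inr ⟨h, rfl⟩)))
  have hgen : Submodule.span (Env (EquivMap ρ τ)) {I.mkQ 1} = ⊤ := by
    rw [eq_top_iff]
    rintro m -
    obtain ⟨b, rfl⟩ := I.mkQ_surjective m
    exact Submodule.mem_span_singleton.2 ⟨b, mk_smul b⟩
  have hle : truncation τ T (PVBar τ X lam) lam ≤ LinearMap.ker f := by
    refine iSup₂_le fun μ hμ => Submodule.span_le.2 fun p hp => ?_
    -- A `U`-linear map preserves weights, and `U/I` has no non-zero vector of weight `μ ∉ lam -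
    -- Q⁺`.
    refine moduleWeightSpace_eq_zero hn hw hgen hμ (m := f p) fun h => ?_
    rw [← map_smul, hp h]
    exact LinearMap.map_smul_of_tower f (μ h) p
  rw [smul_globalWeylVector] at ha
  -- The hypothesis puts `a • (1 ⊗ v)` in the truncated submodule, and its image under `f` is the
  -- class of `a`.
  have h1 : f _ = 0 := hle ((Submodule.Quotient.mk_eq_zero _).1 ha)
  rw [vBar, Induced.toQuotient_smul] at h1
  exact (Submodule.Quotient.mk_eq_zero _).1 h1

end Weyl

end SuperWeyl

end

theorem mainTheorem3 {Γ : Type*} [Group Γ]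
    {𝔤 : Type*} [AddCommGroup 𝔤] [Module ℂ 𝔤] [LieSuperalgebra 𝔤] (h𝔤 : IsBasicClassical 𝔤)
    {A : Type*} [CommRing A] [Algebra ℂ A]
    (ρ : SuperAction Γ 𝔤) (τ : Γ →* (A ≃ₐ[ℂ] A))
    (hΓ : IsBasicClassical ↥ρ.fixed)
    (H : LieSubalgebra ℂ (EvenPart ↥ρ.fixed)) (hH : H.IsCartanSubalgebra)
    (T : TriangularDecomposition H) (X : T.RootVectors)
    (lam : Module.Dual ℂ ↥H) (hlam : lam ∈ T.dominant) :
    IsSupermodule (L := EquivMap ρ τ) (GlobalWeyl.parity τ X lam) ∧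
    globalWeylVector τ X lam ∈ GlobalWeyl.parity τ X lam 0 ∧
    Submodule.span (Env (EquivMap ρ τ)) {globalWeylVector τ X lam} = ⊤ ∧
    (∀ a : Env (EquivMap ρ τ),
      a • globalWeylVector τ X lam = 0 ↔ a ∈ weylRelations τ X lam) := by
  have ann : ∀ a : Env (EquivMap ρ τ),
      a • globalWeylVector τ X lam = 0 ↔ a ∈ weylRelations τ X lam := fun a =>
    ⟨mem_weylRelations_of_smul_eq_zero τ X lam, smul_globalWeylVector_eq_zero τ X lam⟩
  refine ⟨?_, ?_, span_globalWeylVector τ X lam, ann⟩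
  · exact isSupermodule_of_cyclic (span_globalWeylVector τ X lam)
      (fun a ha => (ann _).2 (grade_mem_weylRelations τ X lam ((ann a).1 ha))) _
      (mem_globalWeyl_parity τ X lam)
  · exact (mem_globalWeyl_parity τ X lam 0 _).2 ⟨1, Env.one_mem_parity, one_smul _ _⟩
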